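/- For every $n\ge 1$ let $d=d_n$ and $k=k_n\ge 2$ be integers, $z^*\in[k]^n$ a vector of cluster labels, $\mu_1,\dots,\mu_k\in\mathbb R^d$ pairwise distinct vectors, and $\epsilon=\epsilon_n\ge 0$. Let $X=(X_{i\ell})_{i\in[n],\ell\in[d]}$ be independent real random variables following one of two models. (a) *Laplace mixture:* $X_{i\ell}$ has the Laplace distribution with location $\mu_{z^*_i\ell}$ and scale $\sigma_{z^*_i\ell}$, where the scales $\sigma_{a\ell}>0$ are bounded above by a constant independent of $n$. Put $Y_{i\ell}=X_{i\ell}$. (b) *Exponential family mixture:* $X_{i\ell}$ has density $h_\ell(x)\,e^{u_\ell(x)\theta_{z^*_i\ell}-\psi_\ell(\theta_{z^*_i\ell})}$ with respect to a measure $\nu_\ell$ on $\mathbb R$, where $h_\ell\ge 0$, $u_\ell:\mathbb R\to\mathbb R$, $\psi_\ell(\theta)=\log\int h_\ell e^{u_\ell\theta}\,d\nu_\ell$, and every $\theta_{a\ell}$ lies in the natural parameter space $\{\theta:\int h_\ell e^{u_\ell\theta}\,d\nu_\ell<\infty\}$, which is assumed open. Put $Y_{i\ell}=u_\ell(X_{i\ell})$;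 $\mu_{a\ell}$ is the mean of $u_\ell$ under the parameter $\theta_{a\ell}$. The $Y_{i\ell}$ are uniformly sub-exponential around their means: there is $c>0$ independent of $n,i,\ell$ such that $\mathbb P(|Y_{i\ell}-\mu_{z^*_i\ell}|\ge x)\le 2e^{-cx}$ for all $x\ge 0$. Let $\hat z^{(0)}\in[k]^n$ be an output of the following spectral initialisation. Take a singular value decomposition $\sum_{r=1}^{d\wedge n}s_r v_r w_r^T$, $s_1\ge s_2\ge\dots\ge 0$, of the $d\times n$ matrix whose columns are $Y_1,\dots,Y_n$; let $V=[v_1,\dots,v_k]$ (all the $v_r$, completed by zero columns, if $k>d\wedge n$), and $\hat M=V^TY\in\mathbb R^{k\times n}$; then $\hat z^{(0)}$ is the clustering part of any $(1+\epsilon)$-approximate minimiser, over $z\in[k]^n$ and $\check\mu_1,\dots,\check\mu_k\in\mathbb R^k$, of $\sum_{i=1}^n\|\hat M_{\cdot i}-\check\mu_{z_i}\|_2^2$. Let $\Delta_{\mu,\infty}=\max_{a\ne b}\|\mu_a-\mu_b\|_\infty$, $\delta_{\mu,2}=\min_{a\neq b}\|\mu_a-\mu_b\|_2$, and $\mathrm{loss}(z,z')=\min_{\tau}\#\{i: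 z_i\ne\tau(z'_i)\}$, the minimum being over the permutations $\tau$ of $[k]$. Assume that, as $n\to\infty$: 1. there is a constant $\alpha>0$ such that $\min_{a\in[k]}\#\{i:z_i^*=a\}\ge\alpha n/k$ for all large $n$; 2. $\min(k,\Delta_{\mu,\infty}^{-1})=O(1)$ (for example, $k$ is bounded, or $\Delta_{\mu,\infty}$ is bounded away from $0$); 3. $\Delta_{\mu,\infty}=o\!\left(\dfrac{\delta_{\mu,2}^2}{(1+\epsilon)k^2(1+d/n)}\right)$. Then $\mathrm{loss}(z^*,\hat z^{(0)})=o\big(nk^{-1}\Delta_{\mu,\infty}^{-1}\big)$ in probability: for every $\eta>0$, $\mathbb P\big(\mathrm{loss}(z^*,\hat z^{(0)})>\eta\,nk^{-1}\Delta_{\mu,\infty}^{-1}\big)\to 0$. -/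

import Mathlib

open MeasureTheory ProbabilityTheory Filter Topology
open scoped ENNReal

noncomputable section

namespace SpectralClustering

/-! ### Probability distributions and mixture models -/

/-- The Laplace distribution on `ℝ` with location `m` and scale `s` (meaningful for `s > 0`). -/
def laplaceMeasure (m s : ℝ) : Measure ℝ :=
  volume.withDensity fun x => ENNReal.ofReal ((2 * s)⁻¹ * Real.exp (-(s⁻¹ * |x - m|)))

/-- The data defining a regular one-parameter exponential family on `ℝ`: a reference measure `ν`,
a carrier `h ≥ 0`, and a sufficient statistic `u : ℝ → ℝ`, whose natural parameter space
`{θ | ∫ h(y) exp(u(y) θ) dν(y) < ∞}` is open. -/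
structure ExpFamily where
  ν : Measure ℝ
  h : ℝ → ℝ
  u : ℝ → ℝ
  measurable_h : Measurable h
  measurable_u : Measurable u
  h_nonneg : ∀ y, 0 ≤ h y
  isOpen_param : IsOpen {θ : ℝ | Integrable (fun y => h y * Real.exp (u y * θ)) ν}

namespace ExpFamily

/-- The natural parameter space. -/
def paramSpace (F : ExpFamily) : Set ℝ :=
  {θ : ℝ | Integrable (fun y => F.h y * Real.exp (F.u y * θ)) F.ν}

/-- The log-normaliser (cumulant function) `ψ`. -/
def logNormalizer (F : ExpFamily) (θ : ℝ) : ℝ :=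
  Real.log (∫ y, F.h y * Real.exp (F.u y * θ) ∂F.ν)

/-- The member of the family with natural parameter `θ`, i.e. the measure with density
`h(y) exp(u(y) θ - ψ(θ))` with respect to `ν`. -/
def law (F : ExpFamily) (θ : ℝ) : Measure ℝ :=
  F.ν.withDensity fun y =>
    ENNReal.ofReal (F.h y * Real.exp (F.u y * θ - F.logNormalizer θ))

/-- The mean `𝔼[u(X)]` of the sufficient statistic when `X` has natural parameter `θ`. -/
def mean (F : ExpFamily) (θ : ℝ) : ℝ := ∫ y, F.u y ∂(F.law θ)

end ExpFamily

/-- The random variable `Z` is sub-exponential with constant `c`: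
`ℙ(|Z| ≥ x) ≤ 2 exp (- c x)` for all `x ≥ 0`. -/
def SubExponential {Ω : Type*} [MeasurableSpace Ω] (P : Measure Ω) (c : ℝ) (Z : Ω → ℝ) : Prop :=
  ∀ x : ℝ, 0 ≤ x → P {ω | x ≤ |Z ω|} ≤ ENNReal.ofReal (2 * Real.exp (-(c * x)))

/-- `X` is a sample of `n` points of `ℝ^d` from the Laplace mixture with labels `z`, locations `μ`
and scales `σ`: the `X i ℓ` are independent, with law `Lap (μ (z i) ℓ, σ (z i) ℓ)`. -/
structure IsLaplaceMixture {Ω : Type*} [MeasurableSpace Ω] (P : Measure Ω) {n d k : ℕ}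
    (z : Fin n → Fin k) (μ : Fin k → EuclideanSpace ℝ (Fin d)) (σ : Fin k → Fin d → ℝ)
    (X : Fin n → Fin d → Ω → ℝ) : Prop where
  scale_pos : ∀ a ℓ, 0 < σ a ℓ
  indep : iIndepFun (fun p : Fin n × Fin d => X p.1 p.2) P
  hasLaw : ∀ i ℓ, HasLaw (X i ℓ) (laplaceMeasure (μ (z i) ℓ) (σ (z i) ℓ)) P

/-- `X` is a sample of `n` points of `ℝ^d` from the mixture with labels `z` in which the `ℓ`-th
coordinate of a point of cluster `a` follows the exponential family `F ℓ` with natural parameter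
`θ a ℓ`, all coordinates being independent. -/
structure IsExpFamilyMixture {Ω : Type*} [MeasurableSpace Ω] (P : Measure Ω) {n d k : ℕ}
    (z : Fin n → Fin k) (F : Fin d → ExpFamily) (θ : Fin k → Fin d → ℝ)
    (X : Fin n → Fin d → Ω → ℝ) : Prop where
  param_mem : ∀ a ℓ, θ a ℓ ∈ (F ℓ).paramSpace
  indep : iIndepFun (fun p : Fin n × Fin d => X p.1 p.2) P
  hasLaw : ∀ i ℓ, HasLaw (X i ℓ) ((F ℓ).law (θ (z i) ℓ)) P

/-! ### Cluster geometry and loss -/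

/-- `Δ_{μ,∞} = max_{a ≠ b} ‖μ_a - μ_b‖_∞` (the terms `a = b` vanish). -/
def maxSep {d k : ℕ} (μ : Fin k → EuclideanSpace ℝ (Fin d)) : ℝ :=
  ⨆ q : (Fin k × Fin k) × Fin d, |μ q.1.1 q.2 - μ q.1.2 q.2|

/-- `δ_{μ,2} = min_{a ≠ b} ‖μ_a - μ_b‖_2`. -/
def minSep {d k : ℕ} (μ : Fin k → EuclideanSpace ℝ (Fin d)) : ℝ :=
  ⨅ q : {q : Fin k × Fin k // q.1 ≠ q.2}, ‖μ q.1.1 - μ q.1.2‖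

/-- Number of disagreements between `z` and `z'` up to a permutation of the labels of `z'`. -/
def loss {n k : ℕ} (z z' : Fin n → Fin k) : ℕ :=
  ⨅ τ : Equiv.Perm (Fin k), hammingDist z (τ ∘ z')

/-! ### Spectral initialisation -/

/-- `∑ r, s r • v r (w r)ᵀ` is a singular value decomposition of the `d × n` matrix with columns
`Y 0, …, Y (n - 1)`, the singular values being listed in non-increasing order. -/
structure IsSVD {n d : ℕ} (Y : Fin n → EuclideanSpace ℝ (Fin d)) (s : Fin (min d n) → ℝ)
    (v : Fin (min d n) → EuclideanSpace ℝ (Fin d))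
    (w : Fin (min d n) → EuclideanSpace ℝ (Fin n)) : Prop where
  nonneg : ∀ r, 0 ≤ s r
  antitone : Antitone s
  orthonormal_left : Orthonormal ℝ v
  orthonormal_right : Orthonormal ℝ w
  decomp : ∀ i ℓ, Y i ℓ = ∑ r, s r * v r ℓ * w r i

/-- The column of `Vᵀ Y` that corresponds to the data point `y`, where `V` has columns
`v 0, …, v (k - 1)`. When `k` exceeds the number `m` of available singular vectors, the remaining
columns of `V` are taken to be zero, i.e. all singular vectors are used. -/
def project {d m : ℕ} (k : ℕ) (v : Fin m → EuclideanSpace ℝ (Fin d))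
    (y : EuclideanSpace ℝ (Fin d)) : EuclideanSpace ℝ (Fin k) :=
  WithLp.toLp 2 fun a => if h : a.val < m then inner ℝ (v ⟨a.val, h⟩) y else 0

/-- The `k`-means objective. -/
def kmeansCost {n k m : ℕ} (x : Fin n → EuclideanSpace ℝ (Fin m)) (z : Fin n → Fin k)
    (c : Fin k → EuclideanSpace ℝ (Fin m)) : ℝ :=
  ∑ i, ‖x i - c (z i)‖ ^ 2

/-- `z` is the clustering part of a `(1 + ε)`-approximate minimiser of the `k`-means objective. -/
def IsApproxKMeans {n k m : ℕ} (ε : ℝ) (x : Fin n → EuclideanSpace ℝ (Fin m))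
    (z : Fin n → Fin k) : Prop :=
  ∃ c : Fin k → EuclideanSpace ℝ (Fin m), ∀ (z' : Fin n → Fin k)
    (c' : Fin k → EuclideanSpace ℝ (Fin m)), kmeansCost x z c ≤ (1 + ε) * kmeansCost x z' c'

/-- `z` is a possible output of the spectral initialisation applied to the data points `Y i`:
project on the first `k` left singular vectors of some SVD, then solve `k`-means up to a factor
`1 + ε`. -/
def IsSpectralInit {n d k : ℕ} (ε : ℝ) (Y : Fin n → EuclideanSpace ℝ (Fin d))
    (z : Fin n → Fin k) : Prop :=
  ∃ (s : Fin (min d n) → ℝ) (v : Fin (min d n) → EuclideanSpace ℝ (Fin d))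
    (w : Fin (min d n) → EuclideanSpace ℝ (Fin n)),
    IsSVD Y s v w ∧ IsApproxKMeans ε (fun i => project k v (Y i)) z

end SpectralClustering

end

/-! Write `Y = M + E`, where column `i` of `M` is `μ (z i)`. The whole argument is deterministic
once the operator norm of the noise `E` is at most some `L`; probability enters only in showing that
`L = B √(n + d)` works with probability close to one (`exists_opNorm_bound`).

Deterministic part. `M` has at most `k` distinct columns, hence rank at most `k`, so the singular
values of `Y` beyond the `k`-th are at most `L` (`IsSVD.singularValue_le`). Projecting on the
leading `k` vectors therefore displaces the true centres by a total squared distance of at most `4 k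
L²`. The projected noise has squared Frobenius norm at most `k L²`, and this bounds the `k`-means
cost of the truth; approximate minimality then yields estimated centres at total squared distance at
most `8 (1 + ε) k L²` from the true ones (`IsSpectralInit.exists_centers`). By Markov, at most `32
(1 + ε) k L² / δ²` points are at distance `δ / 2` or more from their true centre. If this number is
below every cluster size, each cluster keeps a good point, which fixes the relabelling, and only bad
points are misclassified. With `L² = B² (n + d)`, the separation hypothesis makes the bound a small
multiple of `n / (k Δ)`.

Operator norm. A grid with Bernstein's inequality does not suffice for sub-exponential entries,
because a large coefficient `a i * b j` spoils the linear regime of the tail. As in the method of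
Kahn and Szemerédi, products of size at most `√N` are treated by Bernstein and a union bound over
the grid, while larger ones are controlled through sums of `|E p|` over all blocks `I × J`, weighted
over dyadic levels (`measure_exists_block_le`, `sum_large_products_le`). -/

noncomputable section

namespace SpectralClustering

/-! ### Exponential moments -/

section ExpMoment

variable {Ω : Type*} [MeasurableSpace Ω] {P : Measure Ω}

/-- The random variable `Z` satisfies `𝔼 exp (c |Z|) ≤ 3`. -/
structure HasExpMoment (P : Measure Ω) (c : ℝ) (Z : Ω → ℝ) : Prop where
  aemeasurable : AEMeasurable Z P
  lintegral_le : ∫⁻ ω, ENNReal.ofReal (Real.exp (c * |Z ω|)) ∂P ≤ 3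

/-- Layer-cake formula: `𝔼 (exp (c |Z| / 2) - 1)` is the integral of `(c / 2) exp (c t / 2) ℙ(|Z| ≥
t)`, at most `∫ c exp (-c t / 2) dt = 2`. -/
lemma SubExponential.hasExpMoment [IsProbabilityMeasure P] {c : ℝ} (hc : 0 < c) {Z : Ω → ℝ}
    (hZ : AEMeasurable Z P) (h : SubExponential P c Z) : HasExpMoment P (c / 2) Z := by
  refine ⟨hZ, ?_⟩
  have hint : ∀ x : ℝ, ∫ t in (0 : ℝ)..x, c / 2 * Real.exp (c / 2 * t)
      = Real.exp (c / 2 * x) - 1 := by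
    intro x
    rw [intervalIntegral.integral_eq_sub_of_hasDerivAt
      (f := fun t => Real.exp (c / 2 * t))]
    · simp
    · intro t _
      have := ((hasDerivAt_id t).const_mul (c / 2)).exp
      simpa [mul_comm] using this
    · exact Continuous.intervalIntegrable (by fun_prop) _ _
  have key := lintegral_comp_eq_lintegral_meas_le_mul P (f := fun ω => |Z ω|)
    (g := fun t => c / 2 * Real.exp (c / 2 * t)) (ae_of_all _ fun ω => abs_nonneg _)
    hZ.abs (fun t _ => Continuous.intervalIntegrable (by fun_prop) _ _)
    (ae_of_all _ fun t => by positivity)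
  simp only [hint] at key
  have h1 : ∫⁻ t in Set.Ioi (0 : ℝ), P {a | t ≤ |Z a|} *
      ENNReal.ofReal (c / 2 * Real.exp (c / 2 * t)) ≤ 2 := by
    calc ∫⁻ t in Set.Ioi (0 : ℝ), P {a | t ≤ |Z a|} *
          ENNReal.ofReal (c / 2 * Real.exp (c / 2 * t))
        ≤ ∫⁻ t in Set.Ioi (0 : ℝ), ENNReal.ofReal (c * Real.exp (-(c / 2) * t)) := by
          refine setLIntegral_mono (by fun_prop) fun t ht => ?_
          refine (mul_le_mul_left (h t (le_of_lt ht)) _).trans ?_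
          rw [← ENNReal.ofReal_mul (by positivity)]
          refine ENNReal.ofReal_le_ofReal (le_of_eq ?_)
          have : Real.exp (-(c * t)) * Real.exp (c / 2 * t) = Real.exp (-(c / 2) * t) := by
            rw [← Real.exp_add]; congr 1; ring
          rw [← this]; ring
      _ = ENNReal.ofReal (∫ t in Set.Ioi (0 : ℝ), c * Real.exp (-(c / 2) * t)) := by
          rw [ofReal_integral_eq_lintegral_ofReal]
          · exact (integrableOn_exp_mul_Ioi (by linarith) 0).const_mul c
          · exact ae_of_all _ fun t => by positivity
      _ = 2 := by
          rw [integral_const_mul, integral_exp_mul_Ioi (by linarith)]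
          have : c * (-Real.exp (-(c / 2) * 0) / -(c / 2)) = 2 := by
            simp; field_simp
          rw [this]; simp
  rw [← key] at h1
  calc ∫⁻ ω, ENNReal.ofReal (Real.exp (c / 2 * |Z ω|)) ∂P
      = ∫⁻ ω, (ENNReal.ofReal (Real.exp (c / 2 * |Z ω|) - 1) + 1) ∂P := by
        refine lintegral_congr fun ω => ?_
        rw [← ENNReal.ofReal_one, ← ENNReal.ofReal_add _ zero_le_one, sub_add_cancel]
        simpa using (by positivity : 0 ≤ c / 2 * |Z ω|)
    _ = ∫⁻ ω, ENNReal.ofReal (Real.exp (c / 2 * |Z ω|) - 1) ∂P + 1 := by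
        rw [lintegral_add_right _ measurable_const]; simp
    _ ≤ 2 + 1 := by gcongr
    _ = 3 := by norm_num

namespace HasExpMoment

lemma mono {c c' : ℝ} (h : c' ≤ c) {Z : Ω → ℝ} (hZ : HasExpMoment P c Z) :
    HasExpMoment P c' Z :=
  ⟨hZ.aemeasurable, (lintegral_mono fun ω => ENNReal.ofReal_le_ofReal (by gcongr)).trans
    hZ.lintegral_le⟩

variable {c : ℝ} {Z : Ω → ℝ}

lemma integrable (hZ : HasExpMoment P c Z) : Integrable (fun ω => Real.exp (c * |Z ω|)) P := by
  refine ⟨(hZ.aemeasurable.abs.const_mul c).exp.aestronglyMeasurable, ?_⟩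
  rw [hasFiniteIntegral_iff_ofReal (ae_of_all _ fun _ => (Real.exp_pos _).le)]
  exact hZ.lintegral_le.trans_lt (by norm_num)

lemma integral_le (hZ : HasExpMoment P c Z) : ∫ ω, Real.exp (c * |Z ω|) ∂P ≤ 3 := by
  rw [integral_eq_lintegral_of_nonneg_ae (ae_of_all _ fun _ => (Real.exp_pos _).le)
    hZ.integrable.aestronglyMeasurable]
  exact ENNReal.toReal_le_of_le_ofReal (by norm_num) (by simpa using hZ.lintegral_le)

lemma integrable_self (hc : 0 < c) (hZ : HasExpMoment P c Z) : Integrable Z P := by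
  refine (hZ.integrable.const_mul c⁻¹).mono' hZ.aemeasurable.aestronglyMeasurable
    (ae_of_all _ fun ω => ?_)
  rw [Real.norm_eq_abs, le_inv_mul_iff₀ hc]
  linarith [Real.add_one_le_exp (c * |Z ω|)]

lemma integrable_exp_mul (hZ : HasExpMoment P c Z) {t : ℝ} (ht : |t| ≤ c) :
    Integrable (fun ω => Real.exp (t * Z ω)) P := by
  refine hZ.integrable.mono' (hZ.aemeasurable.const_mul t).exp.aestronglyMeasurable
    (ae_of_all _ fun ω => ?_)
  rw [Real.norm_eq_abs, Real.abs_exp]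
  refine Real.exp_le_exp.2 ((le_abs_self _).trans ?_)
  rw [abs_mul]; gcongr

lemma _root_.Real.exp_le_one_add_add_sq_mul_exp (x : ℝ) :
    Real.exp x ≤ 1 + x + x ^ 2 * Real.exp |x| := by
  have h := Complex.norm_exp_sub_sum_le_norm_mul_exp (x : ℂ) 2
  simp only [Finset.sum_range_succ, Finset.range_zero, Finset.sum_empty, pow_zero,
    Nat.factorial_zero, Nat.cast_one, div_one, zero_add, pow_one, Nat.factorial_one] at h
  rw [Complex.norm_real, Real.norm_eq_abs, sq_abs] at h
  have h2 : ‖Complex.exp x - (1 + x)‖ = |Real.exp x - (1 + x)| := by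
    rw [← Real.norm_eq_abs, ← Complex.norm_real]; push_cast; rfl
  rw [h2] at h
  linarith [(abs_le.1 h).2]

/-- The linear Taylor term vanishes by centring. Restricting to `|t| ≤ c / 2` leaves half of the
exponential moment to absorb the factor `Z²`. -/
lemma mgf_le [IsProbabilityMeasure P] (hc : 0 < c) (hZ : HasExpMoment P c Z)
    (h0 : ∫ ω, Z ω ∂P = 0) {t : ℝ} (ht : |t| ≤ c / 2) :
    mgf Z P t ≤ Real.exp (24 / c ^ 2 * t ^ 2) := by
  have hint := hZ.integrable
  have hpt : ∀ ω, Real.exp (t * Z ω) ≤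
      1 + t * Z ω + 8 / c ^ 2 * t ^ 2 * Real.exp (c * |Z ω|) := by
    intro ω
    refine (Real.exp_le_one_add_add_sq_mul_exp _).trans ?_
    have hy : 0 ≤ c / 2 * |Z ω| := by positivity
    have h1 : Real.exp |t * Z ω| ≤ Real.exp (c / 2 * |Z ω|) := by
      rw [abs_mul]; gcongr
    have h2 : Z ω ^ 2 ≤ 8 / c ^ 2 * Real.exp (c / 2 * |Z ω|) := by
      have := Real.quadratic_le_exp_of_nonneg hy
      rw [div_mul_eq_mul_div, le_div_iff₀ (by positivity), ← sq_abs]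
      nlinarith
    have h3 : Real.exp (c * |Z ω|) = Real.exp (c / 2 * |Z ω|) * Real.exp (c / 2 * |Z ω|) := by
      rw [← Real.exp_add]; congr 1; ring
    have : (t * Z ω) ^ 2 * Real.exp |t * Z ω| ≤
        t ^ 2 * (8 / c ^ 2 * Real.exp (c / 2 * |Z ω|)) * Real.exp (c / 2 * |Z ω|) := by
      rw [mul_pow]; gcongr
    rw [h3]; linarith
  have hZi := hZ.integrable_self hc
  have hlin : Integrable (fun ω => 1 + t * Z ω) P :=
    (integrable_const _).add (hZi.const_mul t)
  calc mgf Z P t ≤ ∫ ω, (1 + t * Z ω + 8 / c ^ 2 * t ^ 2 * Real.exp (c * |Z ω|)) ∂P := by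
        refine integral_mono (hZ.integrable_exp_mul (ht.trans (by linarith))) ?_ hpt
        exact hlin.add (hint.const_mul _)
    _ = 1 + 8 / c ^ 2 * t ^ 2 * ∫ ω, Real.exp (c * |Z ω|) ∂P := by
        rw [integral_add hlin (hint.const_mul _), integral_add (integrable_const _) (hZi.const_mul t), integral_const_mul,
          integral_const_mul, h0]
        simp
    _ ≤ 1 + 8 / c ^ 2 * t ^ 2 * 3 := by
        gcongr; exact hZ.integral_le
    _ ≤ Real.exp (24 / c ^ 2 * t ^ 2) := by
        have := Real.add_one_le_exp (24 / c ^ 2 * t ^ 2)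
        refine le_trans (le_of_eq ?_) this
        ring

end HasExpMoment

lemma lintegral_exp_laplaceMeasure {m s : ℝ} (hs : 0 < s) :
    ∫⁻ x, ENNReal.ofReal (Real.exp (1 / (2 * s) * |x - m|)) ∂(laplaceMeasure m s) = 2 := by
  rw [laplaceMeasure, lintegral_withDensity_eq_lintegral_mul _ (by fun_prop) (by fun_prop)]
  have h1 : ∀ x : ℝ, ((fun x => ENNReal.ofReal ((2 * s)⁻¹ * Real.exp (-(s⁻¹ * |x - m|)))) *
      fun x => ENNReal.ofReal (Real.exp (1 / (2 * s) * |x - m|))) x =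
      ENNReal.ofReal ((fun y : ℝ => (2 * s)⁻¹ * Real.exp (-(2 * s)⁻¹ * |y|)) (x - m)) := by
    intro x
    simp only [Pi.mul_apply]
    rw [← ENNReal.ofReal_mul (by positivity), mul_assoc, ← Real.exp_add]
    congr 3
    field_simp; ring
  simp only [h1]
  have hneg : -(2 * s)⁻¹ < 0 := by
    have : 0 < (2 * s)⁻¹ := by positivity
    linarith
  have hval : ∫ y : ℝ, (2 * s)⁻¹ * Real.exp (-(2 * s)⁻¹ * |y|) = 2 := by
    rw [integral_comp_abs (f := fun y => (2 * s)⁻¹ * Real.exp (-(2 * s)⁻¹ * y)),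
      integral_const_mul, integral_exp_mul_Ioi hneg]
    simp; field_simp
  rw [lintegral_sub_right_eq_self
    (fun y => ENNReal.ofReal ((2 * s)⁻¹ * Real.exp (-(2 * s)⁻¹ * |y|))) m,
    ← ofReal_integral_eq_lintegral_ofReal, hval]
  · simp
  -- The Bochner integral of a non-integrable function is `0`, so the value `2` already forces
  -- integrability.
  · by_contra hcon
    rw [integral_undef hcon] at hval
    norm_num at hval
  · exact ae_of_all _ fun y => by positivity

lemma integral_laplaceMeasure_sub {m s : ℝ} (hs : 0 < s) :
    ∫ x, (x - m) ∂(laplaceMeasure m s) = 0 := by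
  rw [laplaceMeasure, integral_withDensity_eq_integral_toReal_smul (by fun_prop)
    (ae_of_all _ fun _ => ENNReal.ofReal_lt_top)]
  have h1 : ∀ x : ℝ, (ENNReal.ofReal ((2 * s)⁻¹ * Real.exp (-(s⁻¹ * |x - m|)))).toReal • (x - m) =
      (fun y : ℝ => (2 * s)⁻¹ * Real.exp (-(s⁻¹ * |y|)) * y) (x - m) := by
    intro x
    rw [ENNReal.toReal_ofReal (by positivity)]; rfl
  simp only [h1]
  rw [integral_sub_right_eq_self (fun y : ℝ => (2 * s)⁻¹ * Real.exp (-(s⁻¹ * |y|)) * y) m]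
  have := integral_neg_eq_self (fun y : ℝ => (2 * s)⁻¹ * Real.exp (-(s⁻¹ * |y|)) * y) volume
  simp only [abs_neg, mul_neg, integral_neg] at this
  linarith

end ExpMoment

/-! ### Chernoff bounds for linear combinations of the entries -/

section Chernoff

variable {Ω : Type*} [MeasurableSpace Ω] {P : Measure Ω}
  {ι : Type*} {E : ι → Ω → ℝ} {c : ℝ}

lemma iIndepFun.mul_const (hind : iIndepFun E P) (f : ι → ℝ) :
    iIndepFun (fun p ω => f p * E p ω) P :=
  hind.comp (fun p x => f p * x) fun p => by fun_prop

/-- Reduces to measurable representatives, since the entries are only a.e. measurable. -/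
lemma integrable_exp_mul_sum [IsProbabilityMeasure P] (hind : iIndepFun E P)
    (hE : ∀ p, AEMeasurable (E p) P) {t : ℝ} (s : Finset ι)
    (hint : ∀ p ∈ s, Integrable (fun ω => Real.exp (t * E p ω)) P) :
    Integrable (fun ω => Real.exp (t * ∑ p ∈ s, E p ω)) P := by
  have h := hind.congr (g := fun p => (hE p).mk (E p)) fun p => (hE p).ae_eq_mk
  have h2 := h.integrable_exp_mul_sum (t := t) (fun p => (hE p).measurable_mk) (s := s)
    fun p hp => (hint p hp).congr (by
      filter_upwards [(hE p).ae_eq_mk] with ω hω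
      rw [hω])
  refine h2.congr ?_
  have h3 : ∀ᵐ ω ∂P, ∀ p ∈ s, E p ω = (hE p).mk (E p) ω :=
    (Finset.eventually_all s).2 fun p _ => (hE p).ae_eq_mk
  filter_upwards [h3] with ω hω
  simp only [Finset.sum_apply]
  rw [Finset.sum_congr rfl hω]

lemma measure_le_sum_le_exp [IsProbabilityMeasure P] (hind : iIndepFun E P)
    (hE : ∀ p, AEMeasurable (E p) P) {t : ℝ} (ht : 0 ≤ t) (s : Finset ι)
    (hint : ∀ p ∈ s, Integrable (fun ω => Real.exp (t * E p ω)) P)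
    {b : ι → ℝ} (hb : ∀ p ∈ s, mgf (E p) P t ≤ Real.exp (b p)) (x : ℝ) :
    P {ω | x ≤ ∑ p ∈ s, E p ω} ≤ ENNReal.ofReal (Real.exp (∑ p ∈ s, b p - t * x)) := by
  have h := measure_ge_le_exp_mul_mgf (μ := P) (X := fun ω => ∑ p ∈ s, E p ω) x ht
    (integrable_exp_mul_sum hind hE s hint)
  have h2 := hind.mgf_sum₀ (t := t) hE s
  have h3 : (∑ p ∈ s, E p) = fun ω => ∑ p ∈ s, E p ω := by ext ω; simp
  rw [h3] at h2
  rw [h2] at h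
  refine (ENNReal.le_ofReal_iff_toReal_le (measure_ne_top _ _) (Real.exp_pos _).le).2
    (h.trans ?_)
  calc Real.exp (-t * x) * ∏ p ∈ s, mgf (E p) P t
      ≤ Real.exp (-t * x) * ∏ p ∈ s, Real.exp (b p) := by
        gcongr with p hp
        · exact fun p _ => mgf_nonneg
        · exact hb p hp
    _ = Real.exp (∑ p ∈ s, b p - t * x) := by
        rw [← Real.exp_sum, ← Real.exp_add]; congr 1; ring

/-- Bernstein's inequality for a linear combination of independent centred variables. -/
lemma measure_le_linearCombination [IsProbabilityMeasure P] [Fintype ι] (hc : 0 < c) (hind : iIndepFun E P)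
    (hE : ∀ p, HasExpMoment P c (E p)) (h0 : ∀ p, ∫ ω, E p ω ∂P = 0)
    {f : ι → ℝ} {r v : ℝ} (hr : 0 < r) (hf : ∀ p, |f p| ≤ r) (hv : ∑ p, f p ^ 2 ≤ v) (x : ℝ) :
    P {ω | x ≤ ∑ p, f p * E p ω} ≤
      ENNReal.ofReal (Real.exp (6 * v / r ^ 2 - c / (2 * r) * x)) := by
  have hle : ∀ p, |c / (2 * r) * f p| ≤ c / 2 := by
    intro p
    rw [abs_mul, abs_of_nonneg (by positivity)]
    calc c / (2 * r) * |f p| ≤ c / (2 * r) * r := by gcongr; exact hf p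
      _ = c / 2 := by field_simp
  -- The parameter `c / (2 r)` is the largest for which every `t * f p` stays in the range of
  -- `mgf_le`; it turns `24 / c² * t²` into `6 / r²`.
  have h := measure_le_sum_le_exp (iIndepFun.mul_const hind f)
    (fun p => (hE p).aemeasurable.const_mul _) (t := c / (2 * r)) (by positivity) Finset.univ
    (fun p _ => by
      simpa only [mul_assoc] using (hE p).integrable_exp_mul ((hle p).trans (by linarith)))
    (b := fun p => 6 / r ^ 2 * f p ^ 2)
    (fun p _ => by
      rw [mgf_const_mul, mul_comm (f p)]
      refine ((hE p).mgf_le hc (h0 p) (hle p)).trans (le_of_eq ?_)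
      congr 1; field_simp; ring) x
  refine h.trans (ENNReal.ofReal_le_ofReal (Real.exp_le_exp.2 ?_))
  rw [← Finset.mul_sum]
  have : 6 / r ^ 2 * ∑ p, f p ^ 2 ≤ 6 / r ^ 2 * v := by gcongr
  have h2 : 6 / r ^ 2 * v = 6 * v / r ^ 2 := by ring
  linarith

/-- No cancellation is used: each entry costs a factor `3 ≤ exp 2`, which is affordable in the block
estimate, where a multiple of `|I| |J|` is allowed. -/
lemma measure_le_sum_abs [IsProbabilityMeasure P] (hc : 0 < c) (hind : iIndepFun E P)
    (hE : ∀ p, HasExpMoment P c (E p)) (s : Finset ι) (x : ℝ) :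
    P {ω | x ≤ ∑ p ∈ s, |E p ω|} ≤ ENNReal.ofReal (Real.exp (2 * s.card - c * x)) := by
  have h := measure_le_sum_le_exp (E := fun p ω => |E p ω|)
    (hind.comp (fun _ x => |x|) fun p => by fun_prop)
    (fun p => (hE p).aemeasurable.abs) hc.le s (fun p _ => (hE p).integrable)
    (b := fun _ => 2) (fun p _ => (hE p).integral_le.trans (by
      have := Real.add_one_le_exp 2; linarith)) x
  simpa [mul_comm] using h

end Chernoff

/-! ### Counting -/

section Counting

variable {ι : Type*} [Fintype ι]

lemma exists_sum_half_pow_natAbs_le :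
    ∃ C : ℝ, 0 < C ∧ ∀ s : Finset ℤ, ∑ m ∈ s, (1 / 2 : ℝ) ^ m.natAbs ≤ Real.exp C := by
  have hs : Summable fun m : ℤ => (1 / 2 : ℝ) ^ m.natAbs := by
    rw [summable_int_iff_summable_nat_and_neg]
    simpa using summable_geometric_of_lt_one (r := (1 / 2 : ℝ)) (by norm_num) (by norm_num)
  refine ⟨max 1 (∑' m : ℤ, (1 / 2 : ℝ) ^ m.natAbs), by positivity, fun s => ?_⟩
  calc _ ≤ ∑' m : ℤ, (1 / 2 : ℝ) ^ m.natAbs := hs.sum_le_tsum s fun _ _ => by positivity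
    _ ≤ max 1 (∑' m : ℤ, (1 / 2 : ℝ) ^ m.natAbs) := le_max_right _ _
    _ ≤ _ := by linarith [Real.add_one_le_exp (max 1 (∑' m : ℤ, (1 / 2 : ℝ) ^ m.natAbs))]

/-- The integer vectors of squared Euclidean norm at most `R`. -/
def intBall (ι : Type*) [Fintype ι] [DecidableEq ι] (R : ℕ) : Finset (ι → ℤ) :=
  (Fintype.piFinset fun _ => Finset.Icc (-(R : ℤ)) R).filter fun a => ∑ i, a i ^ 2 ≤ R

lemma mem_intBall [DecidableEq ι] {R : ℕ} {a : ι → ℤ} : a ∈ intBall ι R ↔ ∑ i, a i ^ 2 ≤ R := by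
  refine ⟨fun h => (Finset.mem_filter.1 h).2, fun h => Finset.mem_filter.2 ⟨?_, h⟩⟩
  rw [Fintype.mem_piFinset]
  intro i
  have h1 : a i ^ 2 ≤ R :=
    (Finset.single_le_sum (f := fun i => a i ^ 2) (fun i _ => sq_nonneg (a i))
      (Finset.mem_univ i)).trans h
  rw [Finset.mem_Icc, ← abs_le]
  have h2 := Int.le_self_sq |a i|
  rw [sq_abs] at h2
  exact h2.trans h1

/-- Since `∑ |a i| ≤ ∑ a i ^ 2 ≤ R`, the weight `2 ^ R ∏ 2 ^ (-|a i|)` is at least `1` on the ball,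
and its sum over the enclosing box factorises over the coordinates. -/
lemma card_intBall_le : ∃ C : ℝ, 0 < C ∧ ∀ (ι : Type) [Fintype ι] [DecidableEq ι] (R : ℕ),
    ((intBall ι R).card : ℝ) ≤ Real.exp (R + C * Fintype.card ι) := by
  obtain ⟨C, hC, h⟩ := exists_sum_half_pow_natAbs_le
  refine ⟨C, hC, fun ι _ _ R => ?_⟩
  have h1 : ∀ a ∈ intBall ι R, (1 : ℝ) ≤ 2 ^ R * ∏ i, (1 / 2 : ℝ) ^ (a i).natAbs := by
    intro a ha
    rw [mem_intBall] at ha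
    have h2 : ∑ i, (a i).natAbs ≤ R := by
      zify
      refine (Finset.sum_le_sum fun i _ => ?_).trans ha
      rw [← sq_abs]; exact Int.le_self_sq _
    rw [Finset.prod_pow_eq_pow_sum, one_div, inv_pow, ← div_eq_mul_inv,
      one_le_div (by positivity)]
    exact pow_le_pow_right₀ (by norm_num) h2
  calc ((intBall ι R).card : ℝ) = ∑ a ∈ intBall ι R, (1 : ℝ) := by simp
    _ ≤ ∑ a ∈ intBall ι R, 2 ^ R * ∏ i, (1 / 2 : ℝ) ^ (a i).natAbs := Finset.sum_le_sum h1
    _ ≤ ∑ a ∈ Fintype.piFinset fun _ : ι => Finset.Icc (-(R : ℤ)) R,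
          2 ^ R * ∏ i, (1 / 2 : ℝ) ^ (a i).natAbs :=
        Finset.sum_le_sum_of_subset_of_nonneg (Finset.filter_subset _ _)
          fun _ _ _ => by positivity
    _ = 2 ^ R * ∏ i : ι, ∑ m ∈ Finset.Icc (-(R : ℤ)) R, (1 / 2 : ℝ) ^ m.natAbs := by
        rw [← Finset.mul_sum, Finset.prod_univ_sum]
    _ ≤ Real.exp 1 ^ R * ∏ _i : ι, Real.exp C := by
        refine mul_le_mul (pow_le_pow_left₀ (by norm_num) ?_ _)
          (Finset.prod_le_prod (fun _ _ => Finset.sum_nonneg fun _ _ => by positivity)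
            fun _ _ => h _)
          (Finset.prod_nonneg fun _ _ => Finset.sum_nonneg fun _ _ => by positivity)
          (by positivity)
        linarith [Real.add_one_le_exp 1]
    _ = Real.exp (R + C * Fintype.card ι) := by
        rw [Finset.prod_const, ← Real.exp_nat_mul, ← Real.exp_nat_mul, ← Real.exp_add]
        simp [mul_comm]

/-- The number of subsets of size at most `16 N / 4 ^ s`. -/
lemma card_small_subsets_le {N : ℕ} (hN : Fintype.card ι ≤ N) (s : ℕ) :
    (((Finset.univ : Finset (Finset ι)).filter fun I => I.card * 4 ^ s ≤ 16 * N).card : ℝ) ≤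
      Real.exp (24 * (N / 4 ^ s * (1 + s))) := by
  set F := (Finset.univ : Finset (Finset ι)).filter fun I => I.card * 4 ^ s ≤ 16 * N with hF
  have hlog : Real.log 4 ≤ 23 / 16 := by
    have : Real.log 4 = 2 * Real.log 2 := by
      rw [show (4 : ℝ) = 2 ^ 2 by norm_num, Real.log_pow]; norm_num
    rw [this]; linarith [Real.log_two_lt_d9]
  have hlog0 : 0 < Real.log 4 := Real.log_pos (by norm_num)
  -- The weight `4 ^ (-s |I|)` is compensated on `F` because `16 log 4 ≤ 23`; summed over all
  -- subsets it gives `(1 + 4 ^ (-s)) ^ |ι|`.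
  have h1 : ∀ I ∈ F, (1 : ℝ) ≤ Real.exp (23 * s * (N / 4 ^ s)) * ((4 : ℝ) ^ s)⁻¹ ^ I.card := by
    intro I hI
    have h2 : (I.card : ℝ) * 4 ^ s ≤ 16 * N := by exact_mod_cast (Finset.mem_filter.1 hI).2
    have h3 : ((4 : ℝ) ^ s)⁻¹ ^ I.card = Real.exp (-(I.card * (s * Real.log 4))) := by
      rw [Real.exp_neg, Real.exp_nat_mul, Real.exp_nat_mul, Real.exp_log (by norm_num), inv_pow]
    rw [h3, ← Real.exp_add, Real.one_le_exp_iff]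
    have h4 : (I.card : ℝ) ≤ 16 * (N / 4 ^ s) := by
      rw [← mul_div_assoc, le_div_iff₀ (by positivity)]; exact h2
    have : (I.card : ℝ) * (s * Real.log 4) ≤ 16 * (N / 4 ^ s) * (s * (23 / 16)) := by gcongr
    linarith
  calc (F.card : ℝ) = ∑ I ∈ F, (1 : ℝ) := by simp
    _ ≤ ∑ I ∈ F, Real.exp (23 * s * (N / 4 ^ s)) * ((4 : ℝ) ^ s)⁻¹ ^ I.card :=
        Finset.sum_le_sum h1
    _ ≤ ∑ I : Finset ι, Real.exp (23 * s * (N / 4 ^ s)) * ((4 : ℝ) ^ s)⁻¹ ^ I.card :=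
        Finset.sum_le_sum_of_subset_of_nonneg (Finset.filter_subset _ _)
          fun _ _ _ => by positivity
    _ = Real.exp (23 * s * (N / 4 ^ s)) * (((4 : ℝ) ^ s)⁻¹ + 1) ^ Fintype.card ι := by
        rw [← Finset.mul_sum]
        have := Finset.sum_pow_mul_eq_add_pow ((4 : ℝ) ^ s)⁻¹ 1 (Finset.univ : Finset ι)
        simp only [one_pow, mul_one, Finset.powerset_univ, Finset.card_univ] at this
        rw [this]
    _ ≤ Real.exp (23 * s * (N / 4 ^ s)) * Real.exp (((4 : ℝ) ^ s)⁻¹) ^ Fintype.card ι := by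
        gcongr; exact Real.add_one_le_exp _
    _ ≤ Real.exp (23 * s * (N / 4 ^ s)) * Real.exp (((4 : ℝ) ^ s)⁻¹) ^ N := by
        gcongr; exact Real.one_le_exp (by positivity)
    _ ≤ Real.exp (24 * (N / 4 ^ s * (1 + s))) := by
        rw [← Real.exp_nat_mul, ← Real.exp_add, Real.exp_le_exp, div_eq_mul_inv]
        have : 0 ≤ (N : ℝ) * ((4 : ℝ) ^ s)⁻¹ := by positivity
        have hs : (0 : ℝ) ≤ s := by positivity
        nlinarith

end Counting

/-! ### Large products of grid coordinates -/

section Heavy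

lemma sum_range_one_add_div_two_pow_le (T : ℕ) :
    ∑ s ∈ Finset.range T, (1 + (s : ℝ)) / 2 ^ s ≤ 4 := by
  have h : ∑ s ∈ Finset.range T, (1 + (s : ℝ)) / 2 ^ s = 4 - (T + 2) * 2 / 2 ^ T := by
    induction T with
    | zero => norm_num
    | succ T ih =>
      rw [Finset.sum_range_succ, ih, pow_succ]
      push_cast
      field_simp
      ring
  rw [h]
  have : (0 : ℝ) ≤ (T + 2) * 2 / 2 ^ T := by positivity
  linarith

variable {ι κ : Type*} [Fintype ι] [Fintype κ]

/-- The coordinates `i` with `2 ^ s ≤ |a i| < 2 ^ (s + 1)`. -/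
def dyadicLevel (a : ι → ℤ) (s : ℕ) : Finset ι :=
  Finset.univ.filter fun i => a i ≠ 0 ∧ Nat.log 2 (a i).natAbs = s

variable {a : ι → ℤ} {s : ℕ}

lemma two_pow_le_of_mem_dyadicLevel {i : ι} (hi : i ∈ dyadicLevel a s) :
    (2 : ℝ) ^ s ≤ |(a i : ℝ)| := by
  obtain ⟨-, h0, rfl⟩ := Finset.mem_filter.1 hi
  have := Nat.pow_log_le_self 2 (Int.natAbs_ne_zero.2 h0)
  rw [← Int.cast_abs, Int.abs_eq_natAbs]
  exact_mod_cast this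

lemma le_two_mul_two_pow_of_mem_dyadicLevel {i : ι} (hi : i ∈ dyadicLevel a s) :
    |(a i : ℝ)| ≤ 2 * 2 ^ s := by
  obtain ⟨-, h0, rfl⟩ := Finset.mem_filter.1 hi
  have := (Nat.lt_pow_succ_log_self one_lt_two (a i).natAbs).le
  rw [← Int.cast_abs, Int.abs_eq_natAbs, ← pow_succ']
  exact_mod_cast this

lemma sum_four_pow_mul_card_dyadicLevel_le (a : ι → ℤ) (T : ℕ) :
    ∑ s ∈ Finset.range T, (4 : ℝ) ^ s * (dyadicLevel a s).card ≤ ∑ i, (a i : ℝ) ^ 2 := by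
  calc ∑ s ∈ Finset.range T, (4 : ℝ) ^ s * (dyadicLevel a s).card
      ≤ ∑ s ∈ Finset.range T, ∑ i ∈ dyadicLevel a s, (a i : ℝ) ^ 2 := by
        refine Finset.sum_le_sum fun s _ => ?_
        rw [mul_comm, ← nsmul_eq_mul]
        refine Finset.card_nsmul_le_sum _ _ _ fun i hi => ?_
        rw [show (4 : ℝ) = 2 ^ 2 by norm_num, ← pow_mul, mul_comm 2 s, pow_mul, ← sq_abs (a i : ℝ)]
        exact pow_le_pow_left₀ (by positivity) (two_pow_le_of_mem_dyadicLevel hi) 2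
    _ = ∑ i, ∑ s ∈ Finset.range T,
          if a i ≠ 0 ∧ Nat.log 2 (a i).natAbs = s then (a i : ℝ) ^ 2 else 0 := by
        simp only [dyadicLevel, Finset.sum_filter]
        rw [Finset.sum_comm]
    _ ≤ ∑ i, (a i : ℝ) ^ 2 := by
        refine Finset.sum_le_sum fun i _ => ?_
        calc _ ≤ ∑ s ∈ Finset.range T, if Nat.log 2 (a i).natAbs = s then (a i : ℝ) ^ 2 else 0 := by
              refine Finset.sum_le_sum fun s _ => ?_
              split_ifs with h1 h2 h2
              · exact le_rfl
              · exact absurd h1.2 h2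
              · positivity
              · exact le_rfl
          _ ≤ (a i : ℝ) ^ 2 := by
              rw [Finset.sum_ite_eq]
              split_ifs
              · exact le_rfl
              · positivity

variable {N : ℕ}

lemma card_dyadicLevel_mul_le (ha : ∑ i, a i ^ 2 ≤ ((16 * N : ℕ) : ℤ)) (s : ℕ) :
    (dyadicLevel a s).card * 4 ^ s ≤ 16 * N := by
  have h := (Finset.single_le_sum (f := fun s => (4 : ℝ) ^ s * (dyadicLevel a s).card)
    (fun _ _ => by positivity) (Finset.self_mem_range_succ s)).trans
    (sum_four_pow_mul_card_dyadicLevel_le a (s + 1))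
  have h2 : ∑ i, (a i : ℝ) ^ 2 ≤ ((16 * N : ℕ) : ℝ) := by exact_mod_cast ha
  have h3 := h.trans h2
  rw [mul_comm]
  exact_mod_cast h3

lemma mem_dyadicLevel_log {i : ι} (hi : a i ≠ 0) :
    i ∈ dyadicLevel a (Nat.log 2 (a i).natAbs) :=
  Finset.mem_filter.2 ⟨Finset.mem_univ i, hi, rfl⟩

lemma log_natAbs_lt (ha : ∑ i, a i ^ 2 ≤ ((16 * N : ℕ) : ℤ)) (i : ι) :
    Nat.log 2 (a i).natAbs < Nat.log 2 (Nat.sqrt (16 * N)) + 1 := by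
  refine Nat.lt_succ_of_le (Nat.log_mono_right (Nat.le_sqrt'.2 ?_))
  have h := (Finset.single_le_sum (f := fun i => a i ^ 2) (fun i _ => sq_nonneg (a i))
    (Finset.mem_univ i)).trans ha
  zify
  rwa [sq_abs]

lemma two_pow_log_sqrt_le (hN : 1 ≤ N) :
    (2 : ℝ) ^ (Nat.log 2 (Nat.sqrt (16 * N)) + 1) ≤ 8 * √N := by
  have h1 : 2 ^ Nat.log 2 (Nat.sqrt (16 * N)) ≤ Nat.sqrt (16 * N) :=
    Nat.pow_log_le_self 2 (Nat.sqrt_pos.2 (by omega)).ne'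
  have h2 : ((Nat.sqrt (16 * N) : ℕ) : ℝ) ≤ 4 * √N := by
    refine (Real.nat_sqrt_le_real_sqrt).trans (le_of_eq ?_)
    push_cast
    rw [Real.sqrt_mul (by norm_num), show (16 : ℝ) = 4 ^ 2 by norm_num,
      Real.sqrt_sq (by norm_num)]
  have h3 : (2 : ℝ) ^ Nat.log 2 (Nat.sqrt (16 * N)) ≤ (Nat.sqrt (16 * N) : ℕ) := by
    exact_mod_cast h1
  rw [pow_succ]; linarith

lemma sum_le_sum_dyadicLevel {a : ι → ℤ} {b : κ → ℤ}
    (ha : ∑ i, a i ^ 2 ≤ ((16 * N : ℕ) : ℤ)) (hb : ∑ i, b i ^ 2 ≤ ((16 * N : ℕ) : ℤ))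
    {f : ι × κ → ℝ} (hf0 : ∀ p, 0 ≤ f p) (hf : ∀ p, f p ≠ 0 → a p.1 ≠ 0 ∧ b p.2 ≠ 0)
    {T : ℕ} (hT : T = Nat.log 2 (Nat.sqrt (16 * N)) + 1) :
    ∑ p, f p ≤ ∑ s ∈ Finset.range T, ∑ t ∈ Finset.range T,
      ∑ p ∈ dyadicLevel a s ×ˢ dyadicLevel b t, f p := by
  classical
  have h1 : ∀ p, f p ≤ ∑ s ∈ Finset.range T, ∑ t ∈ Finset.range T,
      if p ∈ dyadicLevel a s ×ˢ dyadicLevel b t then f p else 0 := by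
    intro p
    have hnn : ∀ s t, 0 ≤ if p ∈ dyadicLevel a s ×ˢ dyadicLevel b t then f p else 0 :=
      fun s t => by split_ifs; exacts [hf0 p, le_rfl]
    by_cases hp : f p = 0
    · rw [hp]
      exact Finset.sum_nonneg fun s _ => Finset.sum_nonneg fun t _ => by simp
    obtain ⟨ha0, hb0⟩ := hf p hp
    have hs := log_natAbs_lt ha p.1
    have ht := log_natAbs_lt hb p.2
    rw [← hT] at hs ht
    calc f p = if p ∈ dyadicLevel a (Nat.log 2 (a p.1).natAbs) ×ˢ
          dyadicLevel b (Nat.log 2 (b p.2).natAbs) then f p else 0 := by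
          rw [if_pos (Finset.mem_product.2 ⟨mem_dyadicLevel_log ha0, mem_dyadicLevel_log hb0⟩)]
      _ ≤ ∑ t ∈ Finset.range T, if p ∈ dyadicLevel a (Nat.log 2 (a p.1).natAbs) ×ˢ
          dyadicLevel b t then f p else 0 :=
          Finset.single_le_sum (f := fun t => if p ∈ dyadicLevel a (Nat.log 2 (a p.1).natAbs) ×ˢ
            dyadicLevel b t then f p else 0) (fun t _ => hnn _ t) (Finset.mem_range.2 ht)
      _ ≤ _ := Finset.single_le_sum (f := fun s => ∑ t ∈ Finset.range T,
            if p ∈ dyadicLevel a s ×ˢ dyadicLevel b t then f p else 0)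
            (fun s _ => Finset.sum_nonneg fun t _ => hnn s t) (Finset.mem_range.2 hs)
  refine (Finset.sum_le_sum fun p _ => h1 p).trans (le_of_eq ?_)
  rw [Finset.sum_comm]
  refine Finset.sum_congr rfl fun s _ => ?_
  rw [Finset.sum_comm]
  refine Finset.sum_congr rfl fun t _ => ?_
  rw [← Finset.sum_filter]
  congr 1; ext p; simp

/-- On the block `|a i * b j| ≤ 4 * 2 ^ (s + t)`, so a large product occurs only if `√N < 4 * 2 ^ (s
+ t)`. This permits replacing `2 ^ (s + t)` by `(4 / √N) 4 ^ (s + t)` in front of `|I| |J|`, and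
that term is then summed using the squared norms of `a` and `b`. -/
lemma sum_dyadicLevel_product_le (hN : 1 ≤ N) {K : ℝ} (hK : 0 ≤ K) {A : ι × κ → ℝ}
    (hA : ∀ p, 0 ≤ A p) {a : ι → ℤ} {b : κ → ℤ} {s t : ℕ}
    (h : (dyadicLevel a s).Nonempty → (dyadicLevel b t).Nonempty →
      ∑ p ∈ dyadicLevel a s ×ˢ dyadicLevel b t, A p ≤
        K * ((dyadicLevel a s).card * (dyadicLevel b t).card +
          (N / 4 ^ s * (1 + s) + N / 4 ^ t * (1 + t)))) :
    ∑ p ∈ dyadicLevel a s ×ˢ dyadicLevel b t,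
        (if √N < |(a p.1 : ℝ) * b p.2| then |(a p.1 : ℝ) * b p.2| * A p else 0) ≤
      4 * K * (4 / √N * ((4 ^ s * (dyadicLevel a s).card) * (4 ^ t * (dyadicLevel b t).card)) +
        ((2 ^ s * (N / 4 ^ s * (1 + s))) * 2 ^ t + 2 ^ s * (2 ^ t * (N / 4 ^ t * (1 + t))))) := by
  have hN0 : (0 : ℝ) < √N := Real.sqrt_pos.2 (by exact_mod_cast hN)
  have hnn : 0 ≤ 4 * K * (4 / √N * ((4 ^ s * (dyadicLevel a s).card) *
      (4 ^ t * (dyadicLevel b t).card)) +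
        ((2 ^ s * (N / 4 ^ s * (1 + s))) * 2 ^ t + 2 ^ s * (2 ^ t * (N / 4 ^ t * (1 + t))))) := by
    positivity
  have hle : ∀ p ∈ dyadicLevel a s ×ˢ dyadicLevel b t,
      |(a p.1 : ℝ) * b p.2| ≤ 4 * (2 ^ s * 2 ^ t) := by
    intro p hp
    rw [Finset.mem_product] at hp
    rw [abs_mul]
    calc |(a p.1 : ℝ)| * |(b p.2 : ℝ)| ≤ (2 * 2 ^ s) * (2 * 2 ^ t) := by
          gcongr
          exacts [le_two_mul_two_pow_of_mem_dyadicLevel hp.1,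
            le_two_mul_two_pow_of_mem_dyadicLevel hp.2]
      _ = _ := by ring
  by_cases hbig : √N ≤ 4 * (2 ^ s * 2 ^ t)
  swap
  · rw [Finset.sum_eq_zero fun p hp => if_neg fun hlt => hbig (hlt.le.trans (hle p hp))]
    exact hnn
  rcases (dyadicLevel a s).eq_empty_or_nonempty with hI | hI
  · rw [hI, Finset.empty_product, Finset.sum_empty, ← hI]; exact hnn
  rcases (dyadicLevel b t).eq_empty_or_nonempty with hJ | hJ
  · rw [hJ, Finset.product_empty, Finset.sum_empty, ← hJ]; exact hnn
  have hb1 : ∑ p ∈ dyadicLevel a s ×ˢ dyadicLevel b t,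
        (if √N < |(a p.1 : ℝ) * b p.2| then |(a p.1 : ℝ) * b p.2| * A p else 0) ≤
      4 * (2 ^ s * 2 ^ t) * ∑ p ∈ dyadicLevel a s ×ˢ dyadicLevel b t, A p := by
    rw [Finset.mul_sum]
    refine Finset.sum_le_sum fun p hp => ?_
    split_ifs
    · exact mul_le_mul_of_nonneg_right (hle p hp) (hA p)
    · exact mul_nonneg (by positivity) (hA p)
  refine hb1.trans ((mul_le_mul_of_nonneg_left (h hI hJ) (by positivity)).trans ?_)
  have h2 : (2 : ℝ) ^ s * 2 ^ t ≤ 4 / √N * (4 ^ s * 4 ^ t) := by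
    rw [div_mul_eq_mul_div, le_div_iff₀ hN0, show (4 : ℝ) ^ s = 2 ^ s * 2 ^ s by
      rw [← mul_pow]; norm_num, show (4 : ℝ) ^ t = 2 ^ t * 2 ^ t by rw [← mul_pow]; norm_num]
    have := mul_le_mul_of_nonneg_left hbig (by positivity : (0 : ℝ) ≤ 2 ^ s * 2 ^ t)
    linarith
  have h3 := mul_le_mul_of_nonneg_right h2
    (by positivity : (0 : ℝ) ≤ (dyadicLevel a s).card * (dyadicLevel b t).card)
  have h4 : (2 : ℝ) ^ s * 2 ^ t * ((dyadicLevel a s).card * (dyadicLevel b t).card +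
      ((N : ℝ) / 4 ^ s * (1 + s) + N / 4 ^ t * (1 + t))) ≤
      4 / √N * ((4 ^ s * (dyadicLevel a s).card) * (4 ^ t * (dyadicLevel b t).card)) +
        ((2 ^ s * (N / 4 ^ s * (1 + s))) * 2 ^ t + 2 ^ s * (2 ^ t * (N / 4 ^ t * (1 + t)))) := by
    linarith
  have h5 := mul_le_mul_of_nonneg_left h4 (by positivity : 0 ≤ 4 * K)
  refine le_trans (le_of_eq ?_) h5
  ring

/-- Uniform control of the block sums of a nonnegative array controls the contribution of the large
products `a i * b j` to its value at a pair of grid points. -/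
lemma sum_large_products_le (hN : 1 ≤ N) {K : ℝ} (hK : 0 ≤ K) {A : ι × κ → ℝ}
    (hA : ∀ p, 0 ≤ A p)
    (h : ∀ (s t : ℕ) (I : Finset ι) (J : Finset κ), I.Nonempty → J.Nonempty →
      I.card * 4 ^ s ≤ 16 * N → J.card * 4 ^ t ≤ 16 * N →
      ∑ p ∈ I ×ˢ J, A p ≤
        K * (I.card * J.card + (N / 4 ^ s * (1 + s) + N / 4 ^ t * (1 + t))))
    {a : ι → ℤ} {b : κ → ℤ} (ha : ∑ i, a i ^ 2 ≤ ((16 * N : ℕ) : ℤ))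
    (hb : ∑ i, b i ^ 2 ≤ ((16 * N : ℕ) : ℤ)) :
    ∑ p : ι × κ, (if √N < |(a p.1 : ℝ) * b p.2| then |(a p.1 : ℝ) * b p.2| * A p else 0) ≤
      4352 * K * (N * √N) := by
  have hN0 : (0 : ℝ) < √N := Real.sqrt_pos.2 (by exact_mod_cast hN)
  have hsq : √(N : ℝ) * √N = N := Real.mul_self_sqrt (by positivity)
  obtain ⟨T, hT⟩ : ∃ T, T = Nat.log 2 (Nat.sqrt (16 * N)) + 1 := ⟨_, rfl⟩
  have hsplit := sum_le_sum_dyadicLevel ha hb (f := fun p =>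
      if √N < |(a p.1 : ℝ) * b p.2| then |(a p.1 : ℝ) * b p.2| * A p else 0)
    (fun p => by
      split_ifs
      · exact mul_nonneg (abs_nonneg _) (hA p)
      · exact le_rfl)
    (fun p hp => by
      have hp' : √N < |(a p.1 : ℝ) * b p.2| := by
        by_contra hcon
        exact hp (if_neg hcon)
      have h0 : (a p.1 : ℝ) * b p.2 ≠ 0 := abs_pos.1 (hN0.trans hp')
      exact ⟨by exact_mod_cast left_ne_zero_of_mul h0,
        by exact_mod_cast right_ne_zero_of_mul h0⟩) hT
  refine hsplit.trans ((Finset.sum_le_sum fun s _ => Finset.sum_le_sum fun t _ =>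
    sum_dyadicLevel_product_le hN hK hA fun hI hJ => h s t _ _ hI hJ
      (card_dyadicLevel_mul_le ha s) (card_dyadicLevel_mul_le hb t)).trans ?_)
  have hP : ∑ s ∈ Finset.range T, (4 : ℝ) ^ s * (dyadicLevel a s).card ≤ 16 * N :=
    (sum_four_pow_mul_card_dyadicLevel_le a T).trans (by exact_mod_cast ha)
  have hQ : ∑ s ∈ Finset.range T, (4 : ℝ) ^ s * (dyadicLevel b s).card ≤ 16 * N :=
    (sum_four_pow_mul_card_dyadicLevel_le b T).trans (by exact_mod_cast hb)
  have hU : ∑ s ∈ Finset.range T, (2 : ℝ) ^ s * (N / 4 ^ s * (1 + s)) ≤ N * 4 := by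
    have : ∀ s : ℕ, (2 : ℝ) ^ s * (N / 4 ^ s * (1 + s)) = N * ((1 + s) / 2 ^ s) := by
      intro s
      rw [show (4 : ℝ) = 2 * 2 by norm_num, mul_pow]
      field_simp
    simp only [this, ← Finset.mul_sum]
    gcongr
    exact sum_range_one_add_div_two_pow_le T
  have hW : ∑ s ∈ Finset.range T, (2 : ℝ) ^ s ≤ 8 * √N := by
    refine le_trans ?_ (two_pow_log_sqrt_le hN)
    rw [← hT, geom_sum_eq (by norm_num)]
    linarith
  generalize hPd : (fun s : ℕ => (4 : ℝ) ^ s * (dyadicLevel a s).card) = p at hP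
  generalize hQd : (fun s : ℕ => (4 : ℝ) ^ s * (dyadicLevel b s).card) = q at hQ
  generalize hUd : (fun s : ℕ => (2 : ℝ) ^ s * (N / 4 ^ s * (1 + s))) = u at hU
  have hP0 : 0 ≤ ∑ s ∈ Finset.range T, p s :=
    Finset.sum_nonneg fun s _ => by rw [← hPd]; positivity
  have hQ0 : 0 ≤ ∑ s ∈ Finset.range T, q s :=
    Finset.sum_nonneg fun s _ => by rw [← hQd]; positivity
  have hU0 : 0 ≤ ∑ s ∈ Finset.range T, u s :=
    Finset.sum_nonneg fun s _ => by rw [← hUd]; positivity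
  calc _ = ∑ s ∈ Finset.range T, ∑ t ∈ Finset.range T,
          4 * K * (4 / √N * (p s * q t) + (u s * 2 ^ t + 2 ^ s * u t)) := by
        rw [← hPd, ← hQd, ← hUd]
    _ = 4 * K * (4 / √N * ((∑ s ∈ Finset.range T, p s) * ∑ s ∈ Finset.range T, q s) +
          ((∑ s ∈ Finset.range T, u s) * ∑ s ∈ Finset.range T, (2 : ℝ) ^ s +
           (∑ s ∈ Finset.range T, (2 : ℝ) ^ s) * ∑ s ∈ Finset.range T, u s)) := by
        rw [Finset.sum_mul_sum, Finset.sum_mul_sum, Finset.sum_mul_sum]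
        simp only [Finset.mul_sum, ← Finset.sum_add_distrib]
    -- The three terms are `1024`, `32` and `32` times `N √N`; multiplied by `4` they give `4352`.
    _ ≤ 4 * K * (4 / √N * ((16 * N) * (16 * N)) + ((N * 4) * (8 * √N) + (8 * √N) * (N * 4))) := by
        gcongr
    _ = 4352 * K * (N * √N) := by
        have : 4 / √(N : ℝ) * ((16 * N) * (16 * N)) = 1024 * (N * √N) := by
          rw [div_mul_eq_mul_div, div_eq_iff hN0.ne']
          linear_combination (-1024 * (N : ℝ)) * hsq
        rw [this]; ring

end Heavy

/-! ### The operator norm of a matrix with independent sub-exponential entries -/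

section OpNorm

universe u

variable {Ω : Type u} [MeasurableSpace Ω] {P : Measure Ω} [IsProbabilityMeasure P]
  {ι κ : Type} [Fintype ι] [Fintype κ] {E : ι × κ → Ω → ℝ} {c : ℝ} {N : ℕ}

lemma sum_exp_neg_mul_le {β : ℝ} (hβ : 1 ≤ β) (S : Finset ℕ) :
    ∑ s ∈ S, Real.exp (-(β * (1 + s))) ≤ 2 * Real.exp (-β) := by
  have h1 : ∀ s : ℕ, Real.exp (-(β * (1 + s))) ≤ Real.exp (-β) * (1 / 2) ^ s := by
    intro s
    have h2 : Real.exp (-β) ≤ 1 / 2 := by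
      rw [Real.exp_neg, one_div]
      exact inv_anti₀ (by norm_num) (by linarith [Real.add_one_le_exp β])
    calc Real.exp (-(β * (1 + s))) = Real.exp (-β) * Real.exp (-β) ^ s := by
          rw [← Real.exp_nat_mul, ← Real.exp_add]; congr 1; ring
      _ ≤ _ := by gcongr
  calc _ ≤ ∑ s ∈ S, Real.exp (-β) * (1 / 2) ^ s := Finset.sum_le_sum fun s _ => h1 s
    _ = Real.exp (-β) * ∑ s ∈ S, (1 / 2 : ℝ) ^ s := by rw [Finset.mul_sum]
    _ ≤ Real.exp (-β) * 2 := by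
        gcongr
        exact (summable_geometric_two.sum_le_tsum S fun _ _ => by positivity).trans
          tsum_geometric_two.le
    _ = _ := mul_comm _ _

/-- With high probability all block sums of the absolute values of the entries are controlled. -/
lemma measure_exists_block_le (hc : 0 < c) (hind : iIndepFun E P)
    (hE : ∀ p, HasExpMoment P c (E p)) (hι : Fintype.card ι ≤ N) (hκ : Fintype.card κ ≤ N)
    {K β : ℝ} (hβ : 1 ≤ β) (hK : c * K = 24 + 16 * β) :
    P {ω | ∃ (s t : ℕ) (I : Finset ι) (J : Finset κ), I.Nonempty ∧ J.Nonempty ∧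
      I.card * 4 ^ s ≤ 16 * N ∧ J.card * 4 ^ t ≤ 16 * N ∧
      K * (I.card * J.card + (N / 4 ^ s * (1 + s) + N / 4 ^ t * (1 + t))) <
        ∑ p ∈ I ×ˢ J, |E p ω|} ≤ ENNReal.ofReal ((2 * Real.exp (-β)) ^ 2) := by
  classical
  set u : ℕ → ℝ := fun s => N / 4 ^ s * (1 + s) with hu
  -- A nonempty block at level `s` forces `4 ^ s ≤ 16 N`, so only finitely many levels enter the
  -- union bound.
  set S : Finset ℕ := (Finset.range (16 * N + 1)).filter fun s => 4 ^ s ≤ 16 * N with hS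
  set F : ℕ → Finset (Finset ι) := fun s => Finset.univ.filter fun I => I.card * 4 ^ s ≤ 16 * N
  set G : ℕ → Finset (Finset κ) := fun s => Finset.univ.filter fun I => I.card * 4 ^ s ≤ 16 * N
  have hSmem : ∀ s m : ℕ, 1 ≤ m → m * 4 ^ s ≤ 16 * N → s ∈ S := by
    intro s m hm h
    have h4 : 4 ^ s ≤ 16 * N := by nlinarith [Nat.zero_le (4 ^ s)]
    refine Finset.mem_filter.2 ⟨Finset.mem_range.2 ?_, h4⟩
    have := Nat.lt_pow_self (n := s) (show 1 < 4 by norm_num)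
    omega
  have hKpos : 0 < K := by
    by_contra hcon
    have : c * K ≤ 0 := mul_nonpos_of_nonneg_of_nonpos hc.le (not_lt.1 hcon)
    linarith
  have hsub : {ω | ∃ (s t : ℕ) (I : Finset ι) (J : Finset κ), I.Nonempty ∧ J.Nonempty ∧
      I.card * 4 ^ s ≤ 16 * N ∧ J.card * 4 ^ t ≤ 16 * N ∧
      K * (I.card * J.card + (N / 4 ^ s * (1 + s) + N / 4 ^ t * (1 + t))) <
        ∑ p ∈ I ×ˢ J, |E p ω|} ⊆
      ⋃ s ∈ S, ⋃ t ∈ S, ⋃ I ∈ F s, ⋃ J ∈ G t,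
        {ω | K * (I.card * J.card + (u s + u t)) ≤ ∑ p ∈ I ×ˢ J, |E p ω|} := by
    rintro ω ⟨s, t, I, J, hI, hJ, hIs, hJt, h⟩
    simp only [Set.mem_iUnion, exists_prop]
    exact ⟨s, hSmem s _ hI.card_pos hIs, t, hSmem t _ hJ.card_pos hJt, I,
      Finset.mem_filter.2 ⟨Finset.mem_univ _, hIs⟩, J,
      Finset.mem_filter.2 ⟨Finset.mem_univ _, hJt⟩, h.le⟩
  have hu0 : ∀ s, 0 ≤ u s := fun s => by positivity
  have hone : ∀ s t (I : Finset ι) (J : Finset κ),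
      P {ω | K * (I.card * J.card + (u s + u t)) ≤ ∑ p ∈ I ×ˢ J, |E p ω|} ≤
        ENNReal.ofReal (Real.exp (-(c * K * (u s + u t)))) := by
    intro s t I J
    refine (measure_le_sum_abs hc hind hE _ _).trans
      (ENNReal.ofReal_le_ofReal (Real.exp_le_exp.2 ?_))
    rw [Finset.card_product]
    push_cast
    have : 0 ≤ (I.card : ℝ) * J.card := by positivity
    nlinarith
  -- The number of blocks costs `exp (24 (u s + u t))`, paid by the `24` in `c * K`; the remaining
  -- `16 β` gives the decay.
  have htwo : ∀ s t, P (⋃ I ∈ F s, ⋃ J ∈ G t,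
        {ω | K * (I.card * J.card + (u s + u t)) ≤ ∑ p ∈ I ×ˢ J, |E p ω|}) ≤
        ENNReal.ofReal (Real.exp (-(16 * β * u s)) * Real.exp (-(16 * β * u t))) := by
    intro s t
    calc _ ≤ ∑ I ∈ F s, ∑ J ∈ G t, ENNReal.ofReal (Real.exp (-(c * K * (u s + u t)))) := by
          refine (measure_biUnion_finset_le _ _).trans (Finset.sum_le_sum fun I _ => ?_)
          exact (measure_biUnion_finset_le _ _).trans (Finset.sum_le_sum fun J _ => hone s t I J)
      _ = ENNReal.ofReal ((F s).card * ((G t).card * Real.exp (-(c * K * (u s + u t))))) := by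
          rw [Finset.sum_const, Finset.sum_const, ENNReal.ofReal_mul (by positivity),
            ENNReal.ofReal_mul (by positivity)]
          simp
      _ ≤ _ := by
          refine ENNReal.ofReal_le_ofReal ?_
          calc ((F s).card : ℝ) * ((G t).card * Real.exp (-(c * K * (u s + u t))))
              ≤ Real.exp (24 * u s) * (Real.exp (24 * u t) *
                  Real.exp (-(c * K * (u s + u t)))) := by
                gcongr
                · exact card_small_subsets_le hι s
                · exact card_small_subsets_le hκ t
            _ = _ := by
                simp only [← Real.exp_add]; congr 1; rw [hK]; ring
  -- For `s ∈ S`, `16 u s ≥ 1 + s`: hence the factor `16` beside `β`, which makes the sum over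
  -- levels geometric.
  have huS : ∀ s ∈ S, Real.exp (-(16 * β * u s)) ≤ Real.exp (-(β * (1 + s))) := by
    intro s hs
    have h4 : (4 : ℝ) ^ s ≤ 16 * N := by exact_mod_cast (Finset.mem_filter.1 hs).2
    have h5 : 1 ≤ 16 * ((N : ℝ) / 4 ^ s) := by
      rw [← mul_div_assoc, one_le_div (by positivity)]; exact h4
    have h6 : (1 + (s : ℝ)) ≤ 16 * u s := by
      simp only [hu]
      have : (0 : ℝ) ≤ 1 + s := by positivity
      nlinarith
    rw [Real.exp_le_exp]
    nlinarith
  calc _ ≤ _ := measure_mono hsub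
    _ ≤ ∑ s ∈ S, ∑ t ∈ S,
          ENNReal.ofReal (Real.exp (-(16 * β * u s)) * Real.exp (-(16 * β * u t))) := by
        refine (measure_biUnion_finset_le _ _).trans (Finset.sum_le_sum fun s _ => ?_)
        exact (measure_biUnion_finset_le _ _).trans (Finset.sum_le_sum fun t _ => htwo s t)
    _ = ENNReal.ofReal ((∑ s ∈ S, Real.exp (-(16 * β * u s))) ^ 2) := by
        rw [sq, Finset.sum_mul_sum, ENNReal.ofReal_sum_of_nonneg
          fun s _ => Finset.sum_nonneg fun t _ => by positivity]
        refine Finset.sum_congr rfl fun s _ => ?_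
        rw [ENNReal.ofReal_sum_of_nonneg fun t _ => by positivity]
    _ ≤ _ := by
        refine ENNReal.ofReal_le_ofReal (pow_le_pow_left₀ (by positivity) ?_ 2)
        exact (Finset.sum_le_sum huS).trans (sum_exp_neg_mul_le hβ S)

/-- With high probability the small products contribute `O(N ^ (3 / 2))` at all grid points. -/
lemma measure_exists_small_products_le [DecidableEq ι] [DecidableEq κ]
    (hc : 0 < c) (hind : iIndepFun E P)
    (hE : ∀ p, HasExpMoment P c (E p)) (h0 : ∀ p, ∫ ω, E p ω ∂P = 0) (hN : 1 ≤ N)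
    {C : ℝ} (hCι : ((intBall ι (16 * N)).card : ℝ) ≤ Real.exp (C * N))
    (hCκ : ((intBall κ (16 * N)).card : ℝ) ≤ Real.exp (C * N))
    {T β : ℝ} (hβ : 0 ≤ β) (hT : c * T / 2 = 1536 + 2 * C + β) :
    P {ω | ∃ a ∈ intBall ι (16 * N), ∃ b ∈ intBall κ (16 * N), T * (N * √N) <
      ∑ p : ι × κ, (if √N < |(a p.1 : ℝ) * b p.2| then 0 else (a p.1 : ℝ) * b p.2) * E p ω} ≤
      ENNReal.ofReal (Real.exp (-β)) := by
  have hN1 : (1 : ℝ) ≤ N := by exact_mod_cast hN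
  have hN0 : (0 : ℝ) < √N := Real.sqrt_pos.2 (by linarith)
  have hsq : √(N : ℝ) ^ 2 = N := Real.sq_sqrt (by positivity)
  set f : (ι → ℤ) → (κ → ℤ) → ι × κ → ℝ := fun a b p =>
    if √N < |(a p.1 : ℝ) * b p.2| then 0 else (a p.1 : ℝ) * b p.2 with hf
  have hsub : {ω | ∃ a ∈ intBall ι (16 * N), ∃ b ∈ intBall κ (16 * N), T * (N * √N) <
      ∑ p : ι × κ, f a b p * E p ω} ⊆ ⋃ a ∈ intBall ι (16 * N), ⋃ b ∈ intBall κ (16 * N),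
        {ω | T * (N * √N) ≤ ∑ p : ι × κ, f a b p * E p ω} := by
    rintro ω ⟨a, ha, b, hb, h⟩
    simp only [Set.mem_iUnion, exists_prop]
    exact ⟨a, ha, b, hb, h.le⟩
  have hone : ∀ a ∈ intBall ι (16 * N), ∀ b ∈ intBall κ (16 * N),
      P {ω | T * (N * √N) ≤ ∑ p : ι × κ, f a b p * E p ω} ≤
        ENNReal.ofReal (Real.exp (-(2 * C * N + β))) := by
    intro a ha b hb
    have ha' : ∑ i, (a i : ℝ) ^ 2 ≤ 16 * N := by exact_mod_cast mem_intBall.1 ha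
    have hb' : ∑ i, (b i : ℝ) ^ 2 ≤ 16 * N := by exact_mod_cast mem_intBall.1 hb
    -- Truncation at `r = √N` balances everything at order `N`: the variance term is `6 (16 N)² / N
    -- = 1536 N`, the deviation term `(c T / 2) N`, and the union bound costs `2 C N`.
    refine (measure_le_linearCombination hc hind hE h0 (f := f a b) (r := √N)
      (v := 16 * N * (16 * N)) hN0 (fun p => ?_) ?_ _).trans
      (ENNReal.ofReal_le_ofReal (Real.exp_le_exp.2 ?_))
    · simp only [hf]; split_ifs with h
      · simp
      · exact not_lt.1 h
    · calc ∑ p, f a b p ^ 2 ≤ ∑ p : ι × κ, (a p.1 : ℝ) ^ 2 * (b p.2 : ℝ) ^ 2 := by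
            refine Finset.sum_le_sum fun p _ => ?_
            simp only [hf]; split_ifs with h
            · rw [zero_pow two_ne_zero]; positivity
            · rw [mul_pow]
        _ = (∑ i, (a i : ℝ) ^ 2) * ∑ j, (b j : ℝ) ^ 2 := by
            rw [Finset.sum_mul_sum, Fintype.sum_prod_type]
        _ ≤ _ := by gcongr
    · have h1 : 6 * (16 * N * (16 * N)) / √(N : ℝ) ^ 2 = 1536 * N := by
        rw [hsq]; field_simp; norm_num
      have h2 : c / (2 * √N) * (T * (N * √N)) = c * T / 2 * N := by
        field_simp
      rw [h1, h2, hT]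
      nlinarith
  calc _ ≤ _ := measure_mono hsub
    _ ≤ ∑ a ∈ intBall ι (16 * N), ∑ b ∈ intBall κ (16 * N),
          ENNReal.ofReal (Real.exp (-(2 * C * N + β))) := by
        refine (measure_biUnion_finset_le _ _).trans (Finset.sum_le_sum fun a ha => ?_)
        exact (measure_biUnion_finset_le _ _).trans
          (Finset.sum_le_sum fun b hb => hone a ha b hb)
    _ = ENNReal.ofReal ((intBall ι (16 * N)).card * ((intBall κ (16 * N)).card *
          Real.exp (-(2 * C * N + β)))) := by
        rw [Finset.sum_const, Finset.sum_const, ENNReal.ofReal_mul (by positivity),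
            ENNReal.ofReal_mul (by positivity)]
        simp
    _ ≤ _ := by
        refine ENNReal.ofReal_le_ofReal ?_
        calc _ ≤ Real.exp (C * N) * (Real.exp (C * N) * Real.exp (-(2 * C * N + β))) := by gcongr
          _ = Real.exp (-β) := by
            simp only [← Real.exp_add]; congr 1; ring

/-- Rounding towards zero, so that a rounded vector stays in the unit ball. -/
lemma exists_int_abs_le_abs_sub_le (r : ℝ) : ∃ m : ℤ, |(m : ℝ)| ≤ |r| ∧ |r - m| ≤ 1 := by
  rcases le_total 0 r with h | h
  · refine ⟨⌊r⌋, ?_, ?_⟩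
    · rw [abs_of_nonneg h, abs_of_nonneg (by exact_mod_cast Int.floor_nonneg.2 h)]
      exact Int.floor_le r
    · rw [abs_le]; constructor <;> linarith [Int.floor_le r, Int.lt_floor_add_one r]
  · refine ⟨⌈r⌉, ?_, ?_⟩
    · have : (⌈r⌉ : ℝ) ≤ 0 := by exact_mod_cast Int.ceil_le.2 (by simpa using h)
      rw [abs_of_nonpos h, abs_of_nonpos this]
      linarith [Int.le_ceil r]
    · rw [abs_le]; constructor <;> linarith [Int.le_ceil r, Int.ceil_lt_add_one r]

/-- Rounding the coordinates of a vector of the unit ball to multiples of `1 / (4 √N)`. -/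
lemma exists_grid_approx [DecidableEq ι] (hι : Fintype.card ι ≤ N) (hN : 1 ≤ N) {x : ι → ℝ}
    (hx : ∑ i, x i ^ 2 ≤ 1) :
    ∃ a ∈ intBall ι (16 * N), ∑ i, (a i / (4 * √N)) ^ 2 ≤ 1 ∧
      ∑ i, (4 * (x i - a i / (4 * √N))) ^ 2 ≤ 1 := by
  have hN1 : (1 : ℝ) ≤ N := by exact_mod_cast hN
  have hN0 : (0 : ℝ) < √N := Real.sqrt_pos.2 (by linarith)
  have hsq : √(N : ℝ) ^ 2 = N := Real.sq_sqrt (by positivity)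
  choose a ha using fun i => exists_int_abs_le_abs_sub_le (4 * √N * x i)
  have h1 : ∀ i, ((a i : ℝ) / (4 * √N)) ^ 2 ≤ x i ^ 2 := by
    intro i
    rw [div_pow, div_le_iff₀ (by positivity), ← mul_pow, sq_le_sq, mul_comm (x i)]
    exact (ha i).1
  have h2 : ∑ i, ((a i : ℝ) / (4 * √N)) ^ 2 ≤ 1 := (Finset.sum_le_sum fun i _ => h1 i).trans hx
  refine ⟨a, ?_, h2, ?_⟩
  · rw [mem_intBall]
    have h3 : ∑ i, ((a i : ℝ)) ^ 2 ≤ 16 * N := by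
      simp only [div_pow, ← Finset.sum_div] at h2
      rw [div_le_one (by positivity), mul_pow, hsq] at h2
      linarith
    exact_mod_cast h3
  · have h4 : ∀ i, (4 * (x i - a i / (4 * √N))) ^ 2 ≤ 1 / N := by
      intro i
      have h5 : 4 * (x i - a i / (4 * √N)) = (4 * √N * x i - a i) / √N := by
        field_simp
      rw [h5, div_pow, hsq]
      gcongr
      rw [sq_le_one_iff_abs_le_one]
      exact (ha i).2
    calc _ ≤ ∑ i : ι, 1 / (N : ℝ) := Finset.sum_le_sum fun i _ => h4 i
      _ = Fintype.card ι / N := by simp [div_eq_mul_inv]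
      _ ≤ 1 := by
        rw [div_le_one (by linarith)]; exact_mod_cast hι

/-- A bilinear form bounded at the grid points is bounded on the product of the unit balls. -/
lemma bilinear_le_of_grid [DecidableEq ι] [DecidableEq κ] (hι : Fintype.card ι ≤ N)
    (hκ : Fintype.card κ ≤ N) (hN : 1 ≤ N) {A : ι × κ → ℝ} {T : ℝ}
    (h : ∀ a ∈ intBall ι (16 * N), ∀ b ∈ intBall κ (16 * N),
      ∑ p : ι × κ, (a p.1 : ℝ) * b p.2 * A p ≤ T * (N * √N)) {x : ι → ℝ} {y : κ → ℝ}
    (hx : ∑ i, x i ^ 2 ≤ 1) (hy : ∑ j, y j ^ 2 ≤ 1) :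
    ∑ p : ι × κ, x p.1 * y p.2 * A p ≤ T / 8 * √N := by
  have hN1 : (1 : ℝ) ≤ N := by exact_mod_cast hN
  have hN0 : (0 : ℝ) < √N := Real.sqrt_pos.2 (by linarith)
  have hsq : √(N : ℝ) * √N = N := Real.mul_self_sqrt (by positivity)
  set V : Set ℝ := {r | ∃ (x : ι → ℝ) (y : κ → ℝ), ∑ i, x i ^ 2 ≤ 1 ∧ ∑ j, y j ^ 2 ≤ 1 ∧
    r = ∑ p : ι × κ, x p.1 * y p.2 * A p} with hV
  have hcoord : ∀ {ι : Type} [Fintype ι] {x : ι → ℝ}, ∑ i, x i ^ 2 ≤ 1 → ∀ i, |x i| ≤ 1 := by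
    intro ι _ x hx i
    rw [← sq_le_one_iff_abs_le_one]
    exact (Finset.single_le_sum (f := fun i => x i ^ 2) (fun i _ => sq_nonneg (x i))
      (Finset.mem_univ i)).trans hx
  have hbdd : BddAbove V := by
    refine ⟨∑ p, |A p|, ?_⟩
    rintro r ⟨x, y, hx, hy, rfl⟩
    refine Finset.sum_le_sum fun p _ => (le_abs_self _).trans ?_
    rw [abs_mul, abs_mul]
    have h1 : |x p.1| * |y p.2| ≤ 1 :=
      mul_le_one₀ (hcoord hx _) (abs_nonneg _) (hcoord hy _)
    nlinarith [abs_nonneg (A p)]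
  have hle : ∀ {x : ι → ℝ} {y : κ → ℝ}, ∑ i, x i ^ 2 ≤ 1 → ∑ j, y j ^ 2 ≤ 1 →
      ∑ p : ι × κ, x p.1 * y p.2 * A p ≤ sSup V :=
    fun hx hy => le_csSup hbdd ⟨_, _, hx, hy, rfl⟩
  -- Each rounding error is a quarter of a vector of the unit ball, so the two error terms cost at
  -- most half the supremum. That supremum is finite by `hbdd` and can be absorbed on the left.
  have hstep : ∀ {x : ι → ℝ} {y : κ → ℝ}, ∑ i, x i ^ 2 ≤ 1 → ∑ j, y j ^ 2 ≤ 1 →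
      ∑ p : ι × κ, x p.1 * y p.2 * A p ≤ T / 16 * √N + sSup V / 2 := by
    intro x y hx hy
    obtain ⟨a, ha, ha1, ha2⟩ := exists_grid_approx hι hN hx
    obtain ⟨b, hb, hb1, hb2⟩ := exists_grid_approx hκ hN hy
    have e1 := hle ha2 hy
    have e2 := hle ha1 hb2
    have e3 := h a ha b hb
    have e4 : ∑ p : ι × κ, (a p.1 / (4 * √N)) * (b p.2 / (4 * √N)) * A p =
        (∑ p : ι × κ, (a p.1 : ℝ) * b p.2 * A p) / (16 * N) := by
      rw [Finset.sum_div]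
      refine Finset.sum_congr rfl fun p _ => ?_
      rw [show (16 : ℝ) * N = 4 * √N * (4 * √N) by linear_combination (-16) * hsq]
      field_simp
    have e5 : (∑ p : ι × κ, (a p.1 : ℝ) * b p.2 * A p) / (16 * N) ≤ T / 16 * √N := by
      rw [div_le_iff₀ (by positivity)]
      linarith
    have e6 : ∑ p : ι × κ, x p.1 * y p.2 * A p =
        (∑ p : ι × κ, (4 * (x p.1 - a p.1 / (4 * √N))) * y p.2 * A p) / 4 +
        (∑ p : ι × κ, (a p.1 / (4 * √N)) * (4 * (y p.2 - b p.2 / (4 * √N))) * A p) / 4 +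
        ∑ p : ι × κ, (a p.1 / (4 * √N)) * (b p.2 / (4 * √N)) * A p := by
      rw [Finset.sum_div, Finset.sum_div, ← Finset.sum_add_distrib, ← Finset.sum_add_distrib]
      refine Finset.sum_congr rfl fun p _ => ?_
      ring
    rw [e6, e4]
    linear_combination e1 / 4 + e2 / 4 + e5
  have hsup : sSup V ≤ T / 16 * √N + sSup V / 2 := by
    refine csSup_le ⟨_, x, y, hx, hy, rfl⟩ ?_
    rintro r ⟨x', y', hx', hy', rfl⟩
    exact hstep hx' hy'
  have := hle hx hy
  linarith

lemma card_intBall_le_exp {C : ℝ} (hC : 0 < C) [DecidableEq ι]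
    (h : ((intBall ι (16 * N)).card : ℝ) ≤ Real.exp ((16 * N : ℕ) + C * Fintype.card ι))
    (hι : Fintype.card ι ≤ N) :
    ((intBall ι (16 * N)).card : ℝ) ≤ Real.exp ((16 + C) * N) := by
  refine h.trans (Real.exp_le_exp.2 ?_)
  have : (Fintype.card ι : ℝ) ≤ N := by exact_mod_cast hι
  push_cast
  nlinarith

/-- The operator norm of a matrix with at most `N` rows and columns and independent centred
entries with uniformly bounded exponential moments is `O(√N)` in probability, uniformly. -/
theorem exists_opNorm_bound {c τ : ℝ} (hc : 0 < c) (hτ : 0 < τ) :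
    ∃ B : ℝ, 0 < B ∧ ∀ {Ω : Type u} [MeasurableSpace Ω] {P : Measure Ω} [IsProbabilityMeasure P]
      {ι κ : Type} [Fintype ι] [Fintype κ] {E : ι × κ → Ω → ℝ} {N : ℕ},
      iIndepFun E P → (∀ p, HasExpMoment P c (E p)) → (∀ p, ∫ ω, E p ω ∂P = 0) →
      Fintype.card ι ≤ N → Fintype.card κ ≤ N → 1 ≤ N →
      P {ω | ¬ ∀ (x : ι → ℝ) (y : κ → ℝ), ∑ i, x i ^ 2 ≤ 1 → ∑ j, y j ^ 2 ≤ 1 →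
        ∑ p : ι × κ, x p.1 * y p.2 * E p ω ≤ B * √N} ≤ ENNReal.ofReal τ := by
  classical
  obtain ⟨C, hC, hcard⟩ := card_intBall_le
  -- The two failure probabilities add up to `4 exp (-2 β) + exp (-β) ≤ 5 exp (-β)`.
  obtain ⟨β, hβ1, hβ⟩ : ∃ β : ℝ, 1 ≤ β ∧ 5 * Real.exp (-β) ≤ τ := by
    refine ⟨max 1 (5 / τ), le_max_left _ _, ?_⟩
    have h1 : 5 / τ ≤ Real.exp (max 1 (5 / τ)) :=
      (le_max_right _ _).trans
        ((le_add_of_nonneg_right zero_le_one).trans (Real.add_one_le_exp _))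
    rw [Real.exp_neg, ← div_eq_mul_inv, div_le_iff₀ (Real.exp_pos _)]
    rwa [div_le_iff₀' hτ] at h1
  have hβ0 : 0 ≤ β := by linarith
  have hβτ : (2 * Real.exp (-β)) ^ 2 + Real.exp (-β) ≤ τ := by
    have h1 : Real.exp (-β) ≤ 1 := Real.exp_le_one_iff.2 (by linarith)
    nlinarith [Real.exp_pos (-β)]
  set K : ℝ := (24 + 16 * β) / c with hK
  set T : ℝ := 2 * (1536 + 2 * (16 + C) + β) / c with hT
  have hcK : c * K = 24 + 16 * β := by rw [hK]; field_simp
  have hcT : c * T / 2 = 1536 + 2 * (16 + C) + β := by rw [hT]; field_simp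
  have hK0 : 0 < K := by positivity
  have hT0 : 0 < T := by positivity
  refine ⟨(T + 4352 * K) / 8, by positivity, ?_⟩
  intro Ω _ P _ ι κ _ _ E N hind hE h0 hι hκ hN
  have hA := measure_exists_block_le hc hind hE hι hκ hβ1 hcK
  have hB := measure_exists_small_products_le hc hind hE h0 hN
    (card_intBall_le_exp hC (hcard ι _) hι) (card_intBall_le_exp hC (hcard κ _) hκ)
    hβ0 hcT
  refine (measure_mono ?_).trans ((measure_union_le _ _).trans ((add_le_add hA hB).trans ?_))
  · intro ω hω
    by_contra hcon
    rw [Set.mem_union, not_or] at hcon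
    obtain ⟨hω1, hω2⟩ := hcon
    refine hω fun x y hx hy => bilinear_le_of_grid hι hκ hN (fun a ha b hb => ?_) hx hy
    have h1 := sum_large_products_le hN hK0.le (A := fun p => |E p ω|) (fun p => abs_nonneg _)
      (fun s t I J hI hJ hIs hJt => by
        by_contra hlt
        exact hω1 ⟨s, t, I, J, hI, hJ, hIs, hJt, not_le.1 hlt⟩)
      (mem_intBall.1 ha) (mem_intBall.1 hb)
    have h2 : ∑ p : ι × κ, (if √N < |(a p.1 : ℝ) * b p.2| then 0 else (a p.1 : ℝ) * b p.2) *
        E p ω ≤ T * (N * √N) := by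
      by_contra hlt
      exact hω2 ⟨a, ha, b, hb, not_le.1 hlt⟩
    calc ∑ p : ι × κ, (a p.1 : ℝ) * b p.2 * E p ω
        ≤ ∑ p : ι × κ, (if √N < |(a p.1 : ℝ) * b p.2| then |(a p.1 : ℝ) * b p.2| * |E p ω| else 0)
          + ∑ p : ι × κ, (if √N < |(a p.1 : ℝ) * b p.2| then 0 else (a p.1 : ℝ) * b p.2) *
            E p ω := by
          rw [← Finset.sum_add_distrib]
          refine Finset.sum_le_sum fun p _ => ?_
          split_ifs
          · rw [zero_mul, add_zero, ← abs_mul]; exact le_abs_self _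
          · simp
      _ ≤ 4352 * K * (N * √N) + T * (N * √N) := add_le_add h1 h2
      _ = (T + 4352 * K) * (N * √N) := by ring
  · rw [← ENNReal.ofReal_add (by positivity) (by positivity)]
    exact ENNReal.ofReal_le_ofReal hβτ

end OpNorm

/-! ### Spectral projection -/

section Spectral

variable {n d k m : ℕ}

lemma norm_sq_sum_smul {E ι : Type*} [NormedAddCommGroup E] [InnerProductSpace ℝ E]
    {v : ι → E} (hv : Orthonormal ℝ v) (F : Finset ι) (c : ι → ℝ) :
    ‖∑ r ∈ F, c r • v r‖ ^ 2 = ∑ r ∈ F, c r ^ 2 := by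
  rw [← real_inner_self_eq_norm_sq, hv.inner_sum]
  simp [sq]

/-- The indices of the first `k` singular vectors. -/
def leading (k m : ℕ) : Finset (Fin m) := Finset.univ.filter fun r => r.val < k

/-- The component of a vector orthogonal to the first `k` of the vectors `v`. -/
def residual (k : ℕ) (v : Fin m → EuclideanSpace ℝ (Fin d)) :
    EuclideanSpace ℝ (Fin d) →ₗ[ℝ] EuclideanSpace ℝ (Fin d) :=
  LinearMap.id - ∑ r ∈ leading k m, (innerSL ℝ (v r)).toLinearMap.smulRight (v r)

variable {v : Fin m → EuclideanSpace ℝ (Fin d)}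

lemma residual_apply (y : EuclideanSpace ℝ (Fin d)) :
    residual k v y = y - ∑ r ∈ leading k m, inner ℝ (v r) y • v r := by
  simp [residual]

lemma inner_residual (hv : Orthonormal ℝ v) {r : Fin m} (hr : r ∈ leading k m)
    (y : EuclideanSpace ℝ (Fin d)) : inner ℝ (v r) (residual k v y) = 0 := by
  rw [residual_apply, inner_sub_right,
    hv.inner_right_sum (fun r => inner ℝ (v r) y) hr, sub_self]

lemma residual_self (hv : Orthonormal ℝ v) (r : Fin m) :
    residual k v (v r) = if r ∈ leading k m then 0 else v r := by
  classical
  rw [residual_apply]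
  simp only [orthonormal_iff_ite.1 hv, ite_smul, one_smul, zero_smul, Finset.sum_ite_eq']
  split_ifs <;> simp

/-- Pythagoras' theorem for the decomposition along the leading singular vectors. -/
lemma norm_sq_sum_sub_residual (hv : Orthonormal ℝ v) (c : Fin m → ℝ)
    (y : EuclideanSpace ℝ (Fin d)) :
    ‖∑ r ∈ leading k m, c r • v r - residual k v y‖ ^ 2 =
      ∑ r ∈ leading k m, c r ^ 2 + ‖residual k v y‖ ^ 2 := by
  have h : inner ℝ (∑ r ∈ leading k m, c r • v r) (residual k v y) = 0 := by
    rw [sum_inner]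
    refine Finset.sum_eq_zero fun r hr => ?_
    rw [real_inner_smul_left, inner_residual hv hr, mul_zero]
  rw [norm_sub_sq_real, h, norm_sq_sum_smul hv]
  ring

lemma norm_residual_le (hv : Orthonormal ℝ v) (y : EuclideanSpace ℝ (Fin d)) :
    ‖residual k v y‖ ≤ ‖y‖ := by
  have h := norm_sq_sum_sub_residual (k := k) hv (fun r => - inner ℝ (v r) y) y
  have h2 : ∑ r ∈ leading k m, (- inner ℝ (v r) y) • v r - residual k v y = -y := by
    rw [residual_apply]; simp only [neg_smul, Finset.sum_neg_distrib]; abel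
  rw [h2, norm_neg] at h
  refine le_of_sq_le_sq ?_ (norm_nonneg _)
  rw [h]
  exact le_add_of_nonneg_left (Finset.sum_nonneg fun _ _ => sq_nonneg _)

lemma project_apply_of_lt (y : EuclideanSpace ℝ (Fin d)) (r : Fin m) (h : r.val < k) :
    project k v y ⟨r, h⟩ = inner ℝ (v r) y := by
  simp [project, r.isLt]

/-- The linear combination of the leading singular vectors with coefficients `c`. -/
def lift (v : Fin m → EuclideanSpace ℝ (Fin d)) (c : EuclideanSpace ℝ (Fin k)) :
    EuclideanSpace ℝ (Fin d) :=
  ∑ r ∈ leading k m, (if h : r.val < k then c ⟨r, h⟩ else 0) • v r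

/-- Pythagoras along the leading vectors. Only an inequality: when `k > m`, the last coordinates of
`c` are dropped by `lift`. -/
lemma norm_sq_lift_sub_le (hv : Orthonormal ℝ v) (c : EuclideanSpace ℝ (Fin k))
    (y : EuclideanSpace ℝ (Fin d)) :
    ‖lift v c - y‖ ^ 2 ≤ ‖c - project k v y‖ ^ 2 + ‖residual k v y‖ ^ 2 := by
  have h1 : lift v c - y = ∑ r ∈ leading k m,
      ((if h : r.val < k then c ⟨r, h⟩ else 0) - inner ℝ (v r) y) • v r - residual k v y := by
    rw [residual_apply]
    simp only [sub_smul, Finset.sum_sub_distrib, lift]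
    abel
  rw [h1, norm_sq_sum_sub_residual hv]
  gcongr
  rw [EuclideanSpace.norm_sq_eq]
  have hlt : ∀ r ∈ leading k m, r.val < k := fun r hr => (Finset.mem_filter.1 hr).2
  rw [← Finset.sum_attach]
  calc _ = ∑ r ∈ (leading k m).attach,
        (fun a => ‖(c - project k v y) a‖ ^ 2) (⟨r.1, hlt r.1 r.2⟩ : Fin k) := by
        refine Finset.sum_congr rfl fun r _ => ?_
        have hr := hlt r.1 r.2
        simp only [hr, dif_pos, PiLp.sub_apply, project_apply_of_lt y r.1 hr, Real.norm_eq_abs,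
          sq_abs]
    _ = ∑ a ∈ (leading k m).attach.image fun r => (⟨r.1, hlt r.1 r.2⟩ : Fin k),
        ‖(c - project k v y) a‖ ^ 2 := by
        rw [Finset.sum_image]
        intro r _ r' _ h
        exact Subtype.ext (Fin.ext (Fin.mk.inj_iff.1 h))
    _ ≤ _ := Finset.sum_le_sum_of_subset_of_nonneg (Finset.subset_univ _)
        fun _ _ _ => sq_nonneg _

/-- Each of the `k` coordinates tests the noise against one unit vector, or against zero for a
completing column. -/
lemma sum_norm_sq_project_sub_le {L : ℝ} {v : Fin m → EuclideanSpace ℝ (Fin d)}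
    (hv : Orthonormal ℝ v) {Y M : Fin n → EuclideanSpace ℝ (Fin d)}
    (hE : ∀ u : EuclideanSpace ℝ (Fin d), ∑ i, inner ℝ u (Y i - M i) ^ 2 ≤ L ^ 2 * ‖u‖ ^ 2) :
    ∑ i, ‖project k v (Y i) - project k v (M i)‖ ^ 2 ≤ k * L ^ 2 := by
  simp only [EuclideanSpace.norm_sq_eq]
  rw [Finset.sum_comm]
  calc _ ≤ ∑ a : Fin k, L ^ 2 := by
        refine Finset.sum_le_sum fun a _ => ?_
        by_cases h : a.val < m
        · have := hE (v ⟨a, h⟩)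
          rw [hv.1, one_pow, mul_one] at this
          simpa [project, h, inner_sub_right] using this
        · simp [project, h, sq_nonneg]
    _ = k * L ^ 2 := by simp

end Spectral

/-! ### Singular value decomposition of a low-rank matrix plus noise -/

section SVD

variable {n d k : ℕ} {Y : Fin n → EuclideanSpace ℝ (Fin d)} {s : Fin (min d n) → ℝ}
  {v : Fin (min d n) → EuclideanSpace ℝ (Fin d)} {w : Fin (min d n) → EuclideanSpace ℝ (Fin n)}
  {μ : Fin k → EuclideanSpace ℝ (Fin d)} {z : Fin n → Fin k} {L : ℝ}

lemma IsSVD.sum_smul (h : IsSVD Y s v w) (x : EuclideanSpace ℝ (Fin n)) :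
    ∑ i, x i • Y i = ∑ r, (s r * inner ℝ (w r) x) • v r := by
  ext ℓ
  simp only [WithLp.ofLp_sum, WithLp.ofLp_smul, Finset.sum_apply, Pi.smul_apply, smul_eq_mul,
    h.decomp, PiLp.inner_apply, RCLike.inner_apply, conj_trivial, Finset.mul_sum, Finset.sum_mul]
  rw [Finset.sum_comm]
  refine Finset.sum_congr rfl fun r _ => Finset.sum_congr rfl fun i _ => ?_
  ring

/-- The `(k + 1)`-st singular value of a perturbation of a matrix with `k` distinct columns is at
most the norm of the perturbation. -/
lemma IsSVD.singularValue_le (h : IsSVD Y s v w)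
    (hE : ∀ x : EuclideanSpace ℝ (Fin n), ‖∑ i, x i • (Y i - μ (z i))‖ ≤ L * ‖x‖)
    (hk : k < min d n) : s ⟨k, hk⟩ ≤ L := by
  have hk' : k + 1 ≤ min d n := hk
  set j : Fin (k + 1) → Fin (min d n) := Fin.castLE hk' with hj
  have hjinj : Function.Injective j := Fin.castLE_injective hk'
  -- A combination of the first `k + 1` right singular vectors has `k + 1` free coefficients.
  -- Requiring its entries to sum to zero on each cluster imposes `k` conditions, so a nonzero `x`
  -- exists on which only the noise acts.
  let φ : (Fin (k + 1) → ℝ) →ₗ[ℝ] (Fin k → ℝ) :=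
    { toFun := fun c a => ∑ i ∈ Finset.univ.filter fun i => z i = a, ∑ r, c r * w (j r) i
      map_add' := fun c c' => by
        ext a; simp [add_mul, Finset.sum_add_distrib]
      map_smul' := fun t c => by
        ext a; simp [Finset.mul_sum, mul_assoc] }
  have hker : LinearMap.ker φ ≠ ⊥ := LinearMap.ker_ne_bot_of_finrank_lt (by simp)
  obtain ⟨c, hc, hc0⟩ := (Submodule.ne_bot_iff _).1 hker
  have hc' : ∀ a, ∑ i ∈ Finset.univ.filter fun i => z i = a, ∑ r, c r * w (j r) i = 0 :=
    fun a => congrFun (LinearMap.mem_ker.1 hc) a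
  set x : EuclideanSpace ℝ (Fin n) := ∑ r, c r • w (j r) with hx
  have hxi : ∀ i, x i = ∑ r, c r * w (j r) i := fun i => by simp [hx]
  have how := h.orthonormal_right.comp j hjinj
  have hov := h.orthonormal_left.comp j hjinj
  have hxn : ‖x‖ ^ 2 = ∑ r, c r ^ 2 := norm_sq_sum_smul how Finset.univ c
  have hxpos : 0 < ‖x‖ := by
    refine norm_pos_iff.2 fun h0 => hc0 ?_
    rw [h0, norm_zero, zero_pow two_ne_zero, eq_comm,
      Finset.sum_eq_zero_iff_of_nonneg fun _ _ => sq_nonneg _] at hxn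
    ext r
    simpa using hxn r (Finset.mem_univ r)
  have hM : ∑ i, x i • μ (z i) = 0 := by
    rw [← Finset.sum_fiberwise Finset.univ z]
    refine Finset.sum_eq_zero fun a _ => ?_
    rw [Finset.sum_congr rfl (g := fun i => x i • μ a) fun i hi => by
      rw [(Finset.mem_filter.1 hi).2], ← Finset.sum_smul]
    simp only [hxi, hc' a, zero_smul]
  have hY : ∑ i, x i • (Y i - μ (z i)) = ∑ r, (s r * inner ℝ (w r) x) • v r := by
    simp only [smul_sub, Finset.sum_sub_distrib, hM, sub_zero]
    exact h.sum_smul x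
  have hle := hE x
  rw [hY] at hle
  have hbessel := hov.sum_inner_products_le (∑ r, (s r * inner ℝ (w r) x) • v r)
    (s := Finset.univ)
  have hin : ∀ r : Fin (k + 1), inner ℝ ((v ∘ j) r) (∑ r, (s r * inner ℝ (w r) x) • v r) =
      s (j r) * c r := by
    intro r
    have h1 := h.orthonormal_left.inner_right_sum (fun r => s r * inner ℝ (w r) x)
      (Finset.mem_univ (j r))
    have h2 : inner ℝ (w (j r)) x = c r := how.inner_right_sum c (Finset.mem_univ r)
    rw [Function.comp_apply, h1, h2]
  simp only [hin] at hbessel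
  -- Indices start at `0`, so `s ⟨k, hk⟩` is the smallest of the `k + 1` singular values involved.
  have hlow : s ⟨k, hk⟩ ^ 2 * ‖x‖ ^ 2 ≤
      ∑ r : Fin (k + 1), ‖s (j r) * c r‖ ^ 2 := by
    rw [hxn, Finset.mul_sum]
    refine Finset.sum_le_sum fun r _ => ?_
    rw [Real.norm_eq_abs, sq_abs, mul_pow]
    gcongr
    · exact h.nonneg _
    · refine h.antitone ?_
      rw [Fin.le_def]
      exact Nat.lt_succ_iff.1 r.isLt
  have h3 : (s ⟨k, hk⟩ * ‖x‖) ^ 2 ≤ (L * ‖x‖) ^ 2 := by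
    rw [mul_pow]
    exact hlow.trans (hbessel.trans (pow_le_pow_left₀ (norm_nonneg _) hle 2))
  have h4 : s ⟨k, hk⟩ * ‖x‖ ≤ L * ‖x‖ :=
    le_of_sq_le_sq h3 ((norm_nonneg _).trans hle)
  exact le_of_mul_le_mul_right h4 hxpos

/-- The residual kills the leading terms of the decomposition, and the remaining singular values are
at most `L`. -/
lemma IsSVD.norm_residual_sum_smul_le (h : IsSVD Y s v w) (hL : 0 ≤ L)
    (hE : ∀ x : EuclideanSpace ℝ (Fin n), ‖∑ i, x i • (Y i - μ (z i))‖ ≤ L * ‖x‖)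
    (x : EuclideanSpace ℝ (Fin n)) : ‖residual k v (∑ i, x i • Y i)‖ ≤ L * ‖x‖ := by
  rw [h.sum_smul, map_sum]
  simp only [map_smul, residual_self h.orthonormal_left]
  have h1 : ∑ r, (s r * inner ℝ (w r) x) • (if r ∈ leading k (min d n) then 0 else v r) =
      ∑ r, (if r ∈ leading k (min d n) then 0 else s r * inner ℝ (w r) x) • v r := by
    refine Finset.sum_congr rfl fun r _ => ?_
    split_ifs <;> simp
  rw [h1]
  refine le_of_sq_le_sq ?_ (by positivity)
  rw [norm_sq_sum_smul h.orthonormal_left, mul_pow]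
  calc _ ≤ ∑ r, L ^ 2 * ‖inner ℝ (w r) x‖ ^ 2 := by
        refine Finset.sum_le_sum fun r _ => ?_
        split_ifs with hr
        · rw [zero_pow two_ne_zero]; positivity
        · have hkr : k ≤ r.val := by
            by_contra hlt
            exact hr (Finset.mem_filter.2 ⟨Finset.mem_univ r, not_le.1 hlt⟩)
          have hsr : s r ≤ L :=
            (h.antitone (show (⟨k, hkr.trans_lt r.isLt⟩ : Fin (min d n)) ≤ r from hkr)).trans
              (h.singularValue_le hE (hkr.trans_lt r.isLt))
          rw [mul_pow, Real.norm_eq_abs, sq_abs]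
          have := h.nonneg r
          gcongr
    _ ≤ L ^ 2 * ‖x‖ ^ 2 := by
        rw [← Finset.mul_sum]
        gcongr
        exact h.orthonormal_right.sum_inner_products_le x

/-- Test with the indicator `x` of a cluster `F`: `|F| μ a` is `Y x` minus the noise at `x`, and
both have residual at most `L √|F|`. Hence each cluster contributes at most `4 L²`, whatever its
size. -/
lemma IsSVD.sum_norm_sq_residual_center_le (h : IsSVD Y s v w) (hL : 0 ≤ L)
    (hE : ∀ x : EuclideanSpace ℝ (Fin n), ‖∑ i, x i • (Y i - μ (z i))‖ ≤ L * ‖x‖) :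
    ∑ i, ‖residual k v (μ (z i))‖ ^ 2 ≤ 4 * (k * L ^ 2) := by
  rw [← Finset.sum_fiberwise Finset.univ z]
  calc _ ≤ ∑ a : Fin k, 4 * L ^ 2 := by
        refine Finset.sum_le_sum fun a _ => ?_
        set F := Finset.univ.filter fun i => z i = a with hF
        rw [Finset.sum_congr rfl (g := fun i => ‖residual k v (μ a)‖ ^ 2) fun i hi => by
          rw [(Finset.mem_filter.1 hi).2], Finset.sum_const, nsmul_eq_mul]
        rcases F.card.eq_zero_or_pos with h0 | hpos
        · rw [h0, Nat.cast_zero, zero_mul]; positivity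
        have hpos' : (0 : ℝ) < F.card := by exact_mod_cast hpos
        set x : EuclideanSpace ℝ (Fin n) := WithLp.toLp 2 fun i => if z i = a then 1 else 0
          with hx
        have hxn : ‖x‖ ^ 2 = F.card := by
          rw [EuclideanSpace.norm_sq_eq]
          simp only [hx, hF]
          simp [apply_ite]
        have hs : (F.card : ℝ) • μ a = ∑ i, x i • Y i - ∑ i, x i • (Y i - μ (z i)) := by
          rw [← Finset.sum_sub_distrib]
          simp only [hx, ite_smul, one_smul, zero_smul, smul_sub]
          have : ∀ i, ((if z i = a then Y i else 0) - ((if z i = a then Y i else 0) -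
              if z i = a then μ (z i) else 0)) = if z i = a then μ a else 0 := by
            intro i
            split_ifs with hz
            · rw [hz]; abel
            · simp
          simp only [this]
          rw [← Finset.sum_filter, Finset.sum_const, Nat.cast_smul_eq_nsmul]
        have h1 : ‖residual k v ((F.card : ℝ) • μ a)‖ ≤ 2 * (L * ‖x‖) := by
          rw [hs, map_sub, two_mul]
          exact (norm_sub_le _ _).trans (add_le_add (h.norm_residual_sum_smul_le hL hE x)
            ((norm_residual_le h.orthonormal_left _).trans (hE x)))
        rw [map_smul, norm_smul, Real.norm_of_nonneg hpos'.le] at h1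
        have h2 := pow_le_pow_left₀ (by positivity) h1 2
        rw [mul_pow, mul_pow, mul_pow, hxn] at h2
        have h3 : (F.card : ℝ) * (F.card * ‖residual k v (μ a)‖ ^ 2) ≤ F.card * (4 * L ^ 2) := by
          linarith
        exact le_of_mul_le_mul_left h3 hpos'
    _ = 4 * (k * L ^ 2) := by simp; ring

/-- The estimated centres produced by the spectral method are close on average to the true
centres. -/
theorem IsSpectralInit.exists_centers {ε : ℝ} (hε : 0 ≤ ε) {zh : Fin n → Fin k}
    (h : IsSpectralInit ε Y zh) (hL : 0 ≤ L)
    (hE : ∀ x : EuclideanSpace ℝ (Fin n), ‖∑ i, x i • (Y i - μ (z i))‖ ≤ L * ‖x‖)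
    (hE' : ∀ u : EuclideanSpace ℝ (Fin d),
      ∑ i, inner ℝ u (Y i - μ (z i)) ^ 2 ≤ L ^ 2 * ‖u‖ ^ 2) :
    ∃ θ : Fin k → EuclideanSpace ℝ (Fin d),
      ∑ i, ‖θ (zh i) - μ (z i)‖ ^ 2 ≤ 8 * (1 + ε) * (k * L ^ 2) := by
  obtain ⟨s, v, w, hsvd, c, hc⟩ := h
  have hP := sum_norm_sq_project_sub_le (k := k) hsvd.orthonormal_left (M := fun i => μ (z i)) hE'
  have hR := hsvd.sum_norm_sq_residual_center_le hL hE
  -- The competitor is the true labelling with the projected true centres.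
  have hcost := hc z fun a => project k v (μ a)
  simp only [kmeansCost] at hcost
  have hcost' := hcost.trans (mul_le_mul_of_nonneg_left hP (by linarith : 0 ≤ 1 + ε))
  refine ⟨fun a => lift v (c a), ?_⟩
  -- Summing the three terms gives `2 (1 + ε) + 2 + 4 ≤ 8 (1 + ε)` times `k L²`.
  have hpt : ∀ i, ‖lift v (c (zh i)) - μ (z i)‖ ^ 2 ≤
      2 * ‖project k v (Y i) - c (zh i)‖ ^ 2 +
      2 * ‖project k v (Y i) - project k v (μ (z i))‖ ^ 2 + ‖residual k v (μ (z i))‖ ^ 2 := by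
    intro i
    refine (norm_sq_lift_sub_le hsvd.orthonormal_left _ _).trans ?_
    gcongr
    have h1 : ‖c (zh i) - project k v (μ (z i))‖ ≤ ‖project k v (Y i) - c (zh i)‖ +
        ‖project k v (Y i) - project k v (μ (z i))‖ := by
      rw [norm_sub_rev (project k v (Y i)) (c (zh i))]
      exact norm_sub_le_norm_sub_add_norm_sub _ _ _
    have h2 := pow_le_pow_left₀ (norm_nonneg _) h1 2
    nlinarith [sq_nonneg (‖project k v (Y i) - c (zh i)‖ -
      ‖project k v (Y i) - project k v (μ (z i))‖)]
  refine (Finset.sum_le_sum fun i _ => hpt i).trans ?_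
  rw [Finset.sum_add_distrib, Finset.sum_add_distrib, ← Finset.mul_sum, ← Finset.mul_sum]
  have : 0 ≤ ε * (k * L ^ 2) := by positivity
  linarith

end SVD

/-! ### Counting misclassified points -/

section Loss

variable {n d k : ℕ}

lemma loss_le_card (z z' : Fin n → Fin k) : loss z z' ≤ n := by
  refine (ciInf_le (OrderBot.bddBelow _) (1 : Equiv.Perm (Fin k))).trans ?_
  simpa using hammingDist_le_card_fintype (x := z) (y := (1 : Equiv.Perm (Fin k)) ∘ z')

/-- If the points outside `S` are closer than `δ / 2` to their centre and every cluster has a point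
outside `S`, then only points of `S` are misclassified. -/
lemma loss_le_card_of_forall_notMem {E : Type*} [NormedAddCommGroup E] {μ θ : Fin k → E} {δ : ℝ}
    (hδ : ∀ a b, a ≠ b → δ ≤ ‖μ a - μ b‖) {z zh : Fin n → Fin k} {S : Finset (Fin n)}
    (hS : ∀ i ∉ S, ‖θ (zh i) - μ (z i)‖ < δ / 2) (hrep : ∀ a, ∃ i ∉ S, z i = a) :
    loss z zh ≤ S.card := by
  have hdet : ∀ i ∉ S, ∀ j ∉ S, zh i = zh j → z i = z j := by
    intro i hi j hj hij
    by_contra hne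
    have h1 := hδ _ _ hne
    have h2 := norm_sub_le_norm_sub_add_norm_sub (μ (z i)) (θ (zh i)) (μ (z j))
    have h3 := hS i hi
    have h4 := hS j hj
    rw [norm_sub_rev] at h3
    rw [← hij] at h4
    linarith
  choose rep hrepS hrepz using hrep
  -- Good points with equal estimated labels have equal true labels, so one good point per cluster
  -- defines an injection of the finite label set, hence a permutation.
  have hinj : Function.Injective fun a => zh (rep a) := by
    intro a b hab
    have := hdet _ (hrepS a) _ (hrepS b) hab
    rwa [hrepz, hrepz] at this
  set π : Equiv.Perm (Fin k) := Equiv.ofBijective _ (Finite.injective_iff_bijective.1 hinj)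
    with hπ
  refine (ciInf_le (OrderBot.bddBelow _) π.symm).trans ?_
  refine Finset.card_le_card fun i hi => ?_
  by_contra hiS
  refine (Finset.mem_filter.1 hi).2 ?_
  obtain ⟨a, ha⟩ := π.surjective (zh i)
  have h1 : z (rep a) = z i := hdet _ (hrepS a) _ hiS ha
  rw [Function.comp_apply, ← ha, Equiv.symm_apply_apply, ← h1, hrepz]

/-- Markov's inequality bounds the number of points at distance at least `δ / 2`; the balance
condition prevents them from filling a whole cluster. -/
lemma loss_le_of_sum_norm_sq_le {E : Type*} [NormedAddCommGroup E] {μ θ : Fin k → E} {δ : ℝ}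
    (hδ0 : 0 < δ) (hδ : ∀ a b, a ≠ b → δ ≤ ‖μ a - μ b‖) {z zh : Fin n → Fin k} {R : ℝ}
    (hR : ∑ i, ‖θ (zh i) - μ (z i)‖ ^ 2 ≤ R)
    (hbal : ∀ a, 4 * R / δ ^ 2 < ((Finset.univ.filter fun i => z i = a).card : ℝ)) :
    (loss z zh : ℝ) ≤ 4 * R / δ ^ 2 := by
  set S := Finset.univ.filter fun i => δ / 2 ≤ ‖θ (zh i) - μ (z i)‖ with hS
  have hcard : (S.card : ℝ) ≤ 4 * R / δ ^ 2 := by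
    rw [le_div_iff₀ (by positivity)]
    have h1 : (S.card : ℝ) * (δ / 2) ^ 2 ≤ ∑ i ∈ S, ‖θ (zh i) - μ (z i)‖ ^ 2 := by
      rw [← nsmul_eq_mul]
      exact Finset.card_nsmul_le_sum _ _ _ fun i hi =>
        pow_le_pow_left₀ (by positivity) (Finset.mem_filter.1 hi).2 2
    have h2 : ∑ i ∈ S, ‖θ (zh i) - μ (z i)‖ ^ 2 ≤ ∑ i, ‖θ (zh i) - μ (z i)‖ ^ 2 :=
      Finset.sum_le_sum_of_subset_of_nonneg (Finset.subset_univ _) fun _ _ _ => sq_nonneg _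
    linarith
  refine le_trans ?_ hcard
  exact_mod_cast loss_le_card_of_forall_notMem hδ (S := S) (fun i hi => by
    simpa [hS] using hi) fun a => by
      by_contra! hcon
      have hsub : (Finset.univ.filter fun i => z i = a) ⊆ S := fun i hi => by
        by_contra hiS
        exact hcon i hiS (Finset.mem_filter.1 hi).2
      have : ((Finset.univ.filter fun i => z i = a).card : ℝ) ≤ S.card := by
        exact_mod_cast Finset.card_le_card hsub
      linarith [hbal a]

lemma minSep_le (μ : Fin k → EuclideanSpace ℝ (Fin d)) {a b : Fin k} (h : a ≠ b) :
    minSep μ ≤ ‖μ a - μ b‖ :=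
  ciInf_le (Set.finite_range _).bddBelow (⟨(a, b), h⟩ : {q : Fin k × Fin k // q.1 ≠ q.2})

lemma minSep_pos (hk : 2 ≤ k) {μ : Fin k → EuclideanSpace ℝ (Fin d)}
    (hμ : Function.Injective μ) : 0 < minSep μ := by
  -- Two labels are needed: over an empty index type the real infimum would be `0`.
  have : Nonempty {q : Fin k × Fin k // q.1 ≠ q.2} :=
    ⟨⟨(⟨0, by omega⟩, ⟨1, by omega⟩), by simp⟩⟩
  obtain ⟨q, hq⟩ := exists_eq_ciInf_of_finite
    (f := fun q : {q : Fin k × Fin k // q.1 ≠ q.2} => ‖μ q.1.1 - μ q.1.2‖)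
  rw [minSep, ← hq]
  exact norm_pos_iff.2 (sub_ne_zero.2 fun h => q.2 (hμ h))

lemma maxSep_pos (hk : 2 ≤ k) {μ : Fin k → EuclideanSpace ℝ (Fin d)}
    (hμ : Function.Injective μ) : 0 < maxSep μ := by
  have hne : (⟨0, by omega⟩ : Fin k) ≠ ⟨1, by omega⟩ := by simp
  obtain ⟨ℓ, hℓ⟩ : ∃ ℓ, μ ⟨0, by omega⟩ ℓ ≠ μ ⟨1, by omega⟩ ℓ := by
    by_contra! hcon
    exact hne (hμ (PiLp.ext hcon))
  exact (abs_pos.2 (sub_ne_zero.2 hℓ)).trans_le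
    (le_ciSup (f := fun q : (Fin k × Fin k) × Fin d => |μ q.1.1 q.2 - μ q.1.2 q.2|)
      (Set.finite_range _).bddAbove ((⟨0, by omega⟩, ⟨1, by omega⟩), ℓ))

end Loss

/-! ### The noise of the mixture models -/

section Model

variable {Ω : Type*} [MeasurableSpace Ω] {P : Measure Ω} {n d k : ℕ} {z : Fin n → Fin k}
  {μ : Fin k → EuclideanSpace ℝ (Fin d)} {X Y : Fin n → Fin d → Ω → ℝ}

/-- The deviations of the data from the cluster centres are independent and centred and satisfy
`𝔼 exp (c |·|) ≤ 3`. -/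
structure IsNoise (P : Measure Ω) (z : Fin n → Fin k) (μ : Fin k → EuclideanSpace ℝ (Fin d))
    (Y : Fin n → Fin d → Ω → ℝ) (c : ℝ) : Prop where
  indep : iIndepFun (fun (p : Fin n × Fin d) ω => Y p.1 p.2 ω - μ (z p.1) p.2) P
  expMoment : ∀ p : Fin n × Fin d, HasExpMoment P c fun ω => Y p.1 p.2 ω - μ (z p.1) p.2
  centred : ∀ p : Fin n × Fin d, ∫ ω, (Y p.1 p.2 ω - μ (z p.1) p.2) ∂P = 0

lemma IsLaplaceMixture.isNoise {σ : Fin k → Fin d → ℝ} (h : IsLaplaceMixture P z μ σ X) {S : ℝ}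
    (hS : ∀ a ℓ, σ a ℓ ≤ S) : IsNoise P z μ X (1 / (2 * S)) where
  indep := h.indep.comp (fun p x => x - μ (z p.1) p.2) fun p => by fun_prop
  expMoment p := by
    have hσ := h.scale_pos (z p.1) p.2
    have hlaw := h.hasLaw p.1 p.2
    refine HasExpMoment.mono (c := 1 / (2 * σ (z p.1) p.2)) ?_
      ⟨hlaw.aemeasurable.sub_const _, ?_⟩
    · have := hS (z p.1) p.2
      gcongr
    · rw [hlaw.lintegral_comp (f := fun x => ENNReal.ofReal
        (Real.exp (1 / (2 * σ (z p.1) p.2) * |x - μ (z p.1) p.2|))) (by fun_prop),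
        lintegral_exp_laplaceMeasure hσ]
      norm_num
  centred p := by
    have := (h.hasLaw p.1 p.2).integral_comp (f := fun x => x - μ (z p.1) p.2) (by fun_prop)
    rw [integral_laplaceMeasure_sub (h.scale_pos _ _)] at this
    exact this

lemma IsExpFamilyMixture.isNoise [IsProbabilityMeasure P] {F : Fin d → ExpFamily}
    {θ : Fin k → Fin d → ℝ} (h : IsExpFamilyMixture P z F θ X)
    (hμ : ∀ a ℓ, μ a ℓ = (F ℓ).mean (θ a ℓ)) (hY : ∀ i ℓ ω, Y i ℓ ω = (F ℓ).u (X i ℓ ω))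
    {c : ℝ} (hc : 0 < c)
    (hsub : ∀ i ℓ, SubExponential P c fun ω => Y i ℓ ω - μ (z i) ℓ) :
    IsNoise P z μ Y (c / 2) := by
  have hYX : ∀ i ℓ, Y i ℓ = fun ω => (F ℓ).u (X i ℓ ω) := fun i ℓ => funext (hY i ℓ)
  have hYm : ∀ i ℓ, AEMeasurable (Y i ℓ) P := fun i ℓ => by
    rw [hYX]; exact (F ℓ).measurable_u.comp_aemeasurable (h.hasLaw i ℓ).aemeasurable
  have hexp : ∀ p : Fin n × Fin d,
      HasExpMoment P (c / 2) fun ω => Y p.1 p.2 ω - μ (z p.1) p.2 := fun p =>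
    (hsub p.1 p.2).hasExpMoment hc ((hYm p.1 p.2).sub_const _)
  refine ⟨?_, hexp, fun p => ?_⟩
  · simp only [hY]
    exact h.indep.comp (fun p x => (F p.2).u x - μ (z p.1) p.2) fun p =>
      (F p.2).measurable_u.sub_const _
  · have hint : Integrable (Y p.1 p.2) P := by
      have h1 := (hexp p).integrable_self (by linarith)
      exact (h1.add (integrable_const (μ (z p.1) p.2))).congr (ae_of_all _ fun ω => by simp)
    have hmean := (h.hasLaw p.1 p.2).integral_comp (f := (F p.2).u)
      (F p.2).measurable_u.aestronglyMeasurable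
    have hmean' : ∫ ω, Y p.1 p.2 ω ∂P = μ (z p.1) p.2 := by
      rw [hYX, hμ]; exact hmean
    rw [integral_sub hint (integrable_const _), hmean']
    simp

end Model

/-! ### Bounds for a single sample size -/

section Deterministic

variable {n d k : ℕ}

lemma sum_mul_inner_le {D : Fin n → EuclideanSpace ℝ (Fin d)} {L : ℝ}
    (h : ∀ (x : Fin n → ℝ) (y : Fin d → ℝ), ∑ i, x i ^ 2 ≤ 1 → ∑ j, y j ^ 2 ≤ 1 →
      ∑ p : Fin n × Fin d, x p.1 * y p.2 * D p.1 p.2 ≤ L)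
    (x : EuclideanSpace ℝ (Fin n)) (u : EuclideanSpace ℝ (Fin d)) :
    ∑ i, x i * inner ℝ u (D i) ≤ L * ‖x‖ * ‖u‖ := by
  rcases eq_or_ne x 0 with rfl | hx
  · simp
  rcases eq_or_ne u 0 with rfl | hu
  · simp
  have hx' := norm_pos_iff.2 hx
  have hu' := norm_pos_iff.2 hu
  have hunit : ∀ {m : ℕ} (x : EuclideanSpace ℝ (Fin m)), 0 < ‖x‖ → ∑ i, (x i / ‖x‖) ^ 2 ≤ 1 := by
    intro m x hx
    simp only [div_pow, ← Finset.sum_div]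
    rw [EuclideanSpace.norm_sq_eq, div_le_one]
    · simp
    · rw [← EuclideanSpace.norm_sq_eq]; positivity
  have h1 := h (fun i => x i / ‖x‖) (fun j => u j / ‖u‖) (hunit x hx') (hunit u hu')
  have h2 : ∑ p : Fin n × Fin d, x p.1 / ‖x‖ * (u p.2 / ‖u‖) * D p.1 p.2 =
      (∑ i, x i * inner ℝ u (D i)) / (‖x‖ * ‖u‖) := by
    rw [Fintype.sum_prod_type, Finset.sum_div]
    refine Finset.sum_congr rfl fun i _ => ?_
    simp only [PiLp.inner_apply, RCLike.inner_apply, conj_trivial, Finset.mul_sum,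
      Finset.sum_div]
    refine Finset.sum_congr rfl fun j _ => ?_
    field_simp
  rw [h2, div_le_iff₀ (by positivity)] at h1
  linarith

/-- Duality: take `u` to be the vector `∑ i, x i • D i` itself. The companion `sum_inner_sq_le` does
the same for the transpose. -/
lemma norm_sum_smul_le {D : Fin n → EuclideanSpace ℝ (Fin d)} {L : ℝ} (hL : 0 ≤ L)
    (h : ∀ (x : EuclideanSpace ℝ (Fin n)) (u : EuclideanSpace ℝ (Fin d)),
      ∑ i, x i * inner ℝ u (D i) ≤ L * ‖x‖ * ‖u‖) (x : EuclideanSpace ℝ (Fin n)) :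
    ‖∑ i, x i • D i‖ ≤ L * ‖x‖ := by
  set u := ∑ i, x i • D i with hu
  have h1 := h x u
  have h2 : ∑ i, x i * inner ℝ u (D i) = ‖u‖ * ‖u‖ := by
    rw [← real_inner_self_eq_norm_mul_norm]
    conv_rhs => rw [hu, ← hu]
    nth_rewrite 3 [hu]
    rw [inner_sum]
    simp only [real_inner_smul_right]
  rw [h2] at h1
  rcases (norm_nonneg u).eq_or_lt with h0 | h0
  · rw [← h0]; positivity
  · exact le_of_mul_le_mul_right h1 h0

lemma sum_inner_sq_le {D : Fin n → EuclideanSpace ℝ (Fin d)} {L : ℝ} (hL : 0 ≤ L)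
    (h : ∀ (x : EuclideanSpace ℝ (Fin n)) (u : EuclideanSpace ℝ (Fin d)),
      ∑ i, x i * inner ℝ u (D i) ≤ L * ‖x‖ * ‖u‖) (u : EuclideanSpace ℝ (Fin d)) :
    ∑ i, inner ℝ u (D i) ^ 2 ≤ L ^ 2 * ‖u‖ ^ 2 := by
  set x : EuclideanSpace ℝ (Fin n) := WithLp.toLp 2 fun i => inner ℝ u (D i) with hx
  have h1 := h x u
  have h2 : ∑ i, inner ℝ u (D i) ^ 2 = ‖x‖ ^ 2 := by
    simp [EuclideanSpace.norm_sq_eq, hx]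
  have h3 : ∑ i, x i * inner ℝ u (D i) = ‖x‖ * ‖x‖ := by
    rw [← sq, ← h2]; simp [hx, sq]
  rw [h3] at h1
  have h4 : ‖x‖ ≤ L * ‖u‖ := by
    rcases (norm_nonneg x).eq_or_lt with h0 | h0
    · rw [← h0]; positivity
    · refine le_of_mul_le_mul_right ?_ h0
      linarith
  rw [h2, ← mul_pow]
  exact pow_le_pow_left₀ (norm_nonneg _) h4 2

/-- The loss of the spectral method when the noise matrix has norm at most `L`. -/
theorem IsSpectralInit.loss_le {Y : Fin n → EuclideanSpace ℝ (Fin d)} {z zh : Fin n → Fin k}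
    {μ : Fin k → EuclideanSpace ℝ (Fin d)} (hk : 2 ≤ k) (hμ : Function.Injective μ) {ε L : ℝ}
    (hε : 0 ≤ ε) (hL : 0 ≤ L) (hinit : IsSpectralInit ε Y zh)
    (h : ∀ (x : Fin n → ℝ) (y : Fin d → ℝ), ∑ i, x i ^ 2 ≤ 1 → ∑ j, y j ^ 2 ≤ 1 →
      ∑ p : Fin n × Fin d, x p.1 * y p.2 * (Y p.1 p.2 - μ (z p.1) p.2) ≤ L)
    (hbal : ∀ a, 32 * (1 + ε) * (k * L ^ 2) / minSep μ ^ 2 <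
      ((Finset.univ.filter fun i => z i = a).card : ℝ)) :
    (loss z zh : ℝ) ≤ 32 * (1 + ε) * (k * L ^ 2) / minSep μ ^ 2 := by
  have hbil := sum_mul_inner_le (D := fun i => Y i - μ (z i)) (L := L) (by simpa using h)
  obtain ⟨θ, hθ⟩ := hinit.exists_centers hε hL (norm_sum_smul_le hL hbil)
    (sum_inner_sq_le hL hbil)
  have heq : 4 * (8 * (1 + ε) * (k * L ^ 2)) / minSep μ ^ 2 =
      32 * (1 + ε) * (k * L ^ 2) / minSep μ ^ 2 := by ring
  rw [← heq] at hbal ⊢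
  exact loss_le_of_sum_norm_sq_le (minSep_pos hk hμ) (fun a b hab => minSep_le μ hab) hθ hbal

end Deterministic

end SpectralClustering

end

/-! ### The asymptotic statement -/

theorem lemma5
    -- dimension, number of clusters, labels, cluster centres and accuracy, for each sample size `n`
    (d k : ℕ → ℕ) (hk : ∀ n, 2 ≤ k n)
    (z : (n : ℕ) → Fin n → Fin (k n))
    (μ : (n : ℕ) → Fin (k n) → EuclideanSpace ℝ (Fin (d n)))
    (hμ : ∀ n, Function.Injective (μ n))
    (ε : ℕ → ℝ) (hε : ∀ n, 0 ≤ ε n)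
    -- the data `X` and the matrix `Y` to which the spectral method is applied
    (Ω : ℕ → Type*) [∀ n, MeasurableSpace (Ω n)]
    (P : (n : ℕ) → Measure (Ω n)) [∀ n, IsProbabilityMeasure (P n)]
    (X Y : (n : ℕ) → Fin n → Fin (d n) → Ω n → ℝ)
    (hmodel :
      -- Laplace mixture with bounded scales
      (∃ S : ℝ, ∀ n, ∃ σ : Fin (k n) → Fin (d n) → ℝ,
        (∀ a ℓ, σ a ℓ ≤ S) ∧
        SpectralClustering.IsLaplaceMixture (P n) (z n) (μ n) σ (X n) ∧
        ∀ i ℓ ω, Y n i ℓ ω = X n i ℓ ω) ∨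
      -- exponential family mixture with sub-exponential sufficient statistics
      (∃ c : ℝ, 0 < c ∧ ∀ n, ∃ (F : Fin (d n) → SpectralClustering.ExpFamily)
          (θ : Fin (k n) → Fin (d n) → ℝ),
        SpectralClustering.IsExpFamilyMixture (P n) (z n) F θ (X n) ∧
        (∀ a ℓ, μ n a ℓ = (F ℓ).mean (θ a ℓ)) ∧
        (∀ i ℓ ω, Y n i ℓ ω = (F ℓ).u (X n i ℓ ω)) ∧
        ∀ i ℓ, SpectralClustering.SubExponential (P n) c
          (fun ω => Y n i ℓ ω - μ n (z n i) ℓ)))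
    -- the output of the spectral initialisation
    (zhat : (n : ℕ) → Ω n → Fin n → Fin (k n))
    (hzhat : ∀ n, ∀ᵐ ω ∂(P n), SpectralClustering.IsSpectralInit (ε n)
      (fun i => WithLp.toLp 2 fun ℓ => Y n i ℓ ω) (zhat n ω))
    -- balanced clusters
    (α : ℝ) (hα : 0 < α)
    (hbal : ∀ᶠ n in atTop, ∀ a, α * n / k n ≤ ((Finset.univ.filter fun i => z n i = a).card : ℝ))
    -- `min (k, 1 / Δ) = O(1)`
    (hreg : ∃ C : ℝ, ∀ᶠ n in atTop,
      min (k n : ℝ) (SpectralClustering.maxSep (μ n))⁻¹ ≤ C)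
    (hsep : (fun n => SpectralClustering.maxSep (μ n)) =o[atTop]
      fun n => SpectralClustering.minSep (μ n) ^ 2 /
        ((1 + ε n) * (k n : ℝ) ^ 2 * (1 + (d n : ℝ) / n))) :
    -- `loss (z, zhat) = o (n / (k Δ))` in probability
    ∀ η : ℝ, 0 < η → Tendsto
      (fun n => P n {ω | η * ((n : ℝ) * (k n : ℝ)⁻¹ * (SpectralClustering.maxSep (μ n))⁻¹) <
        (SpectralClustering.loss (z n) (zhat n ω) : ℝ)}) atTop (𝓝 0) := by
  classical
  obtain ⟨c, hc, hnoise⟩ : ∃ c : ℝ, 0 < c ∧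
      ∀ n, SpectralClustering.IsNoise (P n) (z n) (μ n) (Y n) c := by
    rcases hmodel with ⟨S, hS⟩ | ⟨c, hc, h⟩
    -- The maximum guarantees a positive rate, as `S` is not assumed positive.
    · refine ⟨1 / (2 * max S 1), by positivity, fun n => ?_⟩
      obtain ⟨σ, hσ, hX, hYX⟩ := hS n
      have : Y n = X n := by ext i ℓ ω; exact hYX i ℓ ω
      rw [this]
      exact hX.isNoise fun a ℓ => (hσ a ℓ).trans (le_max_left _ _)
    · refine ⟨c / 2, by positivity, fun n => ?_⟩
      obtain ⟨F, θ, hX, hmean, hYX, hsub⟩ := h n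
      exact hX.isNoise hmean hYX hc hsub
  intro η hη
  rw [ENNReal.tendsto_nhds_zero]
  intro τ hτ
  obtain ⟨t, ht, htτ⟩ : ∃ t : ℝ, 0 < t ∧ ENNReal.ofReal t ≤ τ := by
    rcases eq_or_ne τ ⊤ with rfl | hτ'
    · exact ⟨1, one_pos, le_top⟩
    · exact ⟨τ.toReal, ENNReal.toReal_pos hτ.ne' hτ', ENNReal.ofReal_toReal_le⟩
  obtain ⟨B, hB, hop⟩ := SpectralClustering.exists_opNorm_bound hc ht
  obtain ⟨C, hC⟩ := hreg
  set C' : ℝ := max C 1 with hC'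
  have hC'0 : 0 < C' := by positivity
  -- Lower bound for `Δ` outside the trivial case `k Δ ≤ η`. The constant `ρ` below is small enough
  -- both for the target `η` and for the cluster sizes.
  set Δ₀ : ℝ := min 1 η / C' with hΔ₀
  have hΔ₀0 : 0 < Δ₀ := by positivity
  set ρ : ℝ := min η (α * Δ₀ / 2) / (32 * B ^ 2) with hρ
  have hρ0 : 0 < ρ := by positivity
  have hρη : 32 * B ^ 2 * ρ ≤ η := by
    rw [hρ, mul_div_cancel₀ _ (by positivity)]; exact min_le_left _ _
  have hρα : 32 * B ^ 2 * ρ ≤ α * Δ₀ / 2 := by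
    rw [hρ, mul_div_cancel₀ _ (by positivity)]; exact min_le_right _ _
  filter_upwards [hbal, hC, hsep.def hρ0, eventually_ge_atTop 1] with n hbal hC hsep hn
  have hn0 : (0 : ℝ) < n := by exact_mod_cast hn
  have hk0 : (0 : ℝ) < k n := by exact_mod_cast (by have := hk n; omega : 0 < k n)
  have hΔ := SpectralClustering.maxSep_pos (hk n) (hμ n)
  have hδ := SpectralClustering.minSep_pos (hk n) (hμ n)
  have hε1 : 0 < 1 + ε n := by linarith [hε n]
  have hd : (0 : ℝ) < 1 + (d n : ℝ) / n := by positivity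
  set Δ := SpectralClustering.maxSep (μ n) with hΔdef
  set δ := SpectralClustering.minSep (μ n) with hδdef
  rcases le_or_gt (k n * Δ) η with hsmall | hlarge
  -- Here the target is at least `n`, which always bounds the loss.
  · have hempty : {ω | η * ((n : ℝ) * (k n : ℝ)⁻¹ * Δ⁻¹) <
        (SpectralClustering.loss (z n) (zhat n ω) : ℝ)} = ∅ := by
      refine Set.eq_empty_of_forall_notMem fun ω hω => ?_
      have h1 : (SpectralClustering.loss (z n) (zhat n ω) : ℝ) ≤ n := by
        exact_mod_cast SpectralClustering.loss_le_card _ _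
      have h2 : (n : ℝ) ≤ η * ((n : ℝ) * (k n : ℝ)⁻¹ * Δ⁻¹) := by
        have : η * ((n : ℝ) * (k n : ℝ)⁻¹ * Δ⁻¹) = η * n / (k n * Δ) := by field_simp
        rw [this, le_div_iff₀ (by positivity), mul_comm η]
        gcongr
      exact absurd hω (not_lt.2 (h1.trans h2))
    rw [hempty, measure_empty]
    exact zero_le
  -- Either `Δ⁻¹` is bounded directly, or `k` is bounded and `k Δ > η` transfers the bound to `Δ`.
  have hΔ₀Δ : Δ₀ ≤ Δ := by
    rw [hΔ₀, div_le_iff₀ hC'0]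
    rcases min_le_iff.1 (hC.trans (le_max_left C 1)) with h1 | h1
    · calc min 1 η ≤ η := min_le_right _ _
        _ ≤ k n * Δ := hlarge.le
        _ ≤ Δ * C' := by rw [mul_comm]; gcongr
    · refine (min_le_left _ _).trans ?_
      rwa [inv_le_iff_one_le_mul₀' hΔ] at h1
  have hq : (1 + ε n) * (k n : ℝ) ^ 2 * (1 + (d n : ℝ) / n) * Δ ≤ ρ * δ ^ 2 := by
    rw [Real.norm_of_nonneg hΔ.le, Real.norm_of_nonneg (by positivity), ← mul_div_assoc,
      le_div_iff₀ (by positivity)] at hsep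
    linarith
  -- Uses `n + d = n (1 + d / n)`. Of the two factors `k` in the separation condition, one comes
  -- from the `k` projected coordinates and the other from the scale `n / (k Δ)`.
  have hbound : 32 * (1 + ε n) * (k n * (B * √((n + d n : ℕ) : ℝ)) ^ 2) / δ ^ 2 ≤
      32 * B ^ 2 * ρ * (n / (k n * Δ)) := by
    rw [mul_pow, Real.sq_sqrt (by positivity), div_le_iff₀ (by positivity)]
    have h1 := mul_le_mul_of_nonneg_left hq
      (by positivity : 0 ≤ 32 * B ^ 2 * (n / (k n * Δ)))
    refine le_trans (le_of_eq ?_) (h1.trans (le_of_eq ?_))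
    · push_cast; field_simp
    · ring
  have hbad := hop (hnoise n).indep (hnoise n).expMoment (hnoise n).centred
    (N := n + d n) (by simp) (by simp) (by omega)
  refine le_trans (measure_mono_ae ?_) (hbad.trans htτ)
  filter_upwards [hzhat n] with ω hω hlt
  by_contra hgood
  have hgood' := not_not.1 hgood
  have hloss := hω.loss_le (hk n) (hμ n) (hε n)
    (by positivity : 0 ≤ B * √((n + d n : ℕ) : ℝ)) hgood' fun a => by
      refine (hbound.trans_lt ?_).trans_le (hbal a)
      -- The error bound is at most `(α Δ₀ / 2) n / (k Δ)`, strictly below the cluster size `α n /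
      -- k` because `Δ₀ ≤ Δ`.
      have h1 : α * n / k n = α * Δ * (n / (k n * Δ)) := by field_simp
      rw [h1]
      have h2 : α * Δ₀ ≤ α * Δ := by gcongr
      have h3 : 0 < α * Δ₀ := by positivity
      exact mul_lt_mul_of_pos_right (by linarith) (by positivity)
  have hfinal : 32 * B ^ 2 * ρ * (n / (k n * Δ)) ≤ η * ((n : ℝ) * (k n : ℝ)⁻¹ * Δ⁻¹) := by
    have : (n : ℝ) * (k n : ℝ)⁻¹ * Δ⁻¹ = n / (k n * Δ) := by field_simp
    rw [this]
    gcongr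
  exact absurd hlt (not_lt.2 (hloss.trans (hbound.trans hfinal)))
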